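/- Let $H=L^2((0,\infty),t^{-2}\,dt)$ be the Hilbert space of complex-valued functions with inner product $\langle f,g\rangle=\int_0^\infty f(t)\overline{g(t)}\,t^{-2}\,dt$. For integers $k\ge 1$ let $e_k(t)=\{t/k\}$ (fractional part), and let $\chi(t)=1$ for $t\ge 1$, $\chi(t)=0$ for $0<t<1$, and $\kappa(t)=t$ for $0<t<1$, $\kappa(t)=0$ for $t\ge 1$; all these functions belong to $H$. Let $D\subset H$ be the closed subspace of functions of the form $f(t)=\lambda t+\varphi(t)$ with $\lambda\in\mathbb C$ and $\varphi$ constant on each interval $[j,j+1)$, $j=0,1,2,\dots$, the constant being $0$ for $j=0$. For $f\in D$ one has $\lambda=\langle f,\kappa\rangle$, and $h=f-\lambda e_1$ is constant on each $[j,j+1)$, with value denoted by $h(j)$ (and $h(0)=0$). For $n\ge 1$ put $$u(n;f)=-\lambda+h(n)-h(n-1),\qquad w(n;f)=\sum_{d\mid n}\mu(n/d)\,u(d;f),$$ where $\mu$ is the Möbius function. Let $\mathcal B$ be the linear span of the $e_n$ ($n\ge 1$) and $\mathcal B_0$ the linear span of the $e_n-e_1/n$ ($n\ge 2$); their closures in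 $H$ are contained in $D$. Let $\widetilde\chi$ and $\widetilde\chi_0$ be the orthogonal projections of $\chi$ on $\overline{\mathcal B}$ and $\overline{\mathcal B_0}$, and put $\nu(n)=w(n;\widetilde\chi)$ and $\nu_0(n)=w(n;\widetilde\chi_0)$ for $n\ge 1$. Then the following assertions are equivalent: (i) $\nu(n)=\mu(n)$ for every $n\ge 1$; (ii) $\nu_0(n)=\mu(n)$ for every $n\ge 2$; (iii) the Riemann hypothesis is true. -/

import Mathlib

open MeasureTheory Set

noncomputable section

namespace BaezDuarte

/-- The measure `t⁻² dt` on `(0, ∞)`. -/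
def weight : Measure ℝ :=
  (volume.restrict (Ioi (0 : ℝ))).withDensity (fun t => ENNReal.ofReal (1 / t ^ 2))

/-- The complex Hilbert space `H = L²(0, ∞; t⁻² dt)`.
In Mathlib's convention `inner ℂ g f = ∫ f(t) * conj (g t) t⁻² dt`. -/
abbrev H : Type := Lp ℂ 2 weight

lemma memLp_of_bound {f : ℝ → ℂ} (hf : Measurable f)
    (hb : ∀ t : ℝ, 0 < t → ‖f t‖ ≤ min t 1) : MemLp f 2 weight := by
  rw [memLp_two_iff_integrable_sq_norm hf.aestronglyMeasurable, weight,
    integrable_withDensity_iff_integrable_smul' (by fun_prop) (by simp)]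
  have hmeas : Measurable
      (fun t : ℝ => (ENNReal.ofReal (1 / t ^ 2)).toReal • ‖f t‖ ^ 2) := by fun_prop
  have hval : ∀ t : ℝ, (ENNReal.ofReal (1 / t ^ 2)).toReal • ‖f t‖ ^ 2
      = 1 / t ^ 2 * ‖f t‖ ^ 2 := fun t => by
    rw [ENNReal.toReal_ofReal (by positivity), smul_eq_mul]
  have hU : Ioi (0 : ℝ) = Ioc 0 1 ∪ Ioi 1 := (Ioc_union_Ioi_eq_Ioi zero_le_one).symm
  change IntegrableOn _ (Ioi (0 : ℝ)) volume
  rw [hU]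
  refine IntegrableOn.union ?_ ?_
  · refine Integrable.mono' (g := fun _ => (1 : ℝ)) (by simp)
      hmeas.aestronglyMeasurable ?_
    filter_upwards [ae_restrict_mem measurableSet_Ioc] with t ht
    rw [hval, Real.norm_of_nonneg (by positivity)]
    have h1 : ‖f t‖ ≤ t := (hb t ht.1).trans (min_le_left _ _)
    have h2 : 0 < t ^ 2 := by have := ht.1; positivity
    rw [one_div_mul_eq_div, div_le_one h2]
    gcongr
  · refine Integrable.mono' (g := fun t : ℝ => t ^ (-2 : ℝ))
      (integrableOn_Ioi_rpow_of_lt (by norm_num) one_pos) hmeas.aestronglyMeasurable ?_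
    filter_upwards [ae_restrict_mem measurableSet_Ioi] with t ht
    have ht0 : (0 : ℝ) < t := lt_trans one_pos ht
    rw [hval, Real.norm_of_nonneg (by positivity), Real.rpow_neg ht0.le, Real.rpow_two,
      ← one_div]
    have h1 : ‖f t‖ ≤ 1 := (hb t ht0).trans (min_le_right _ _)
    have h3 : ‖f t‖ ^ 2 ≤ 1 := pow_le_one₀ (norm_nonneg _) h1
    exact mul_le_of_le_one_right (by positivity) h3

/-- `e_k(t) = {t / k}`, the fractional part (meant for `k ≥ 1`). -/
def eFun (k : ℕ) (t : ℝ) : ℂ := ((Int.fract (t / k) : ℝ) : ℂ)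

/-- `χ(t) = [t ≥ 1]`. -/
def chiFun : ℝ → ℂ := (Ici (1 : ℝ)).indicator (fun _ => 1)

/-- `κ(t) = t [0 < t < 1]`. -/
def kappaFun : ℝ → ℂ := (Ioo (0 : ℝ) 1).indicator (fun t => (t : ℂ))

lemma memLp_eFun (k : ℕ) : MemLp (eFun k) 2 weight := by
  refine memLp_of_bound ?_ fun t ht => ?_
  · unfold eFun
    exact Complex.measurable_ofReal.comp (measurable_fract.comp (measurable_id.div_const _))
  · rw [eFun, Complex.norm_real, Real.norm_of_nonneg (Int.fract_nonneg _)]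
    refine le_min ?_ (Int.fract_lt_one _).le
    rcases Nat.eq_zero_or_pos k with rfl | hk
    · simpa using ht.le
    have hk1 : (1 : ℝ) ≤ k := by exact_mod_cast hk
    have h0 : 0 ≤ t / k := by positivity
    have h1 : Int.fract (t / k) ≤ t / k := by
      have : (0 : ℝ) ≤ ⌊t / k⌋ := by exact_mod_cast Int.floor_nonneg.mpr h0
      rw [Int.fract]; linarith
    exact h1.trans (div_le_self ht.le hk1)

lemma memLp_chiFun : MemLp chiFun 2 weight := by
  refine memLp_of_bound (measurable_const.indicator measurableSet_Ici) fun t ht => ?_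
  by_cases h : t ∈ Ici (1 : ℝ)
  · rw [chiFun, indicator_of_mem h]; simpa using h
  · rw [chiFun, indicator_of_notMem h]; simpa using ht.le

lemma memLp_kappaFun : MemLp kappaFun 2 weight := by
  refine memLp_of_bound (Complex.measurable_ofReal.indicator measurableSet_Ioo) fun t ht => ?_
  by_cases h : t ∈ Ioo (0 : ℝ) 1
  · rw [kappaFun, indicator_of_mem h, Complex.norm_real, Real.norm_of_nonneg ht.le]
    exact le_min le_rfl h.2.le
  · rw [kappaFun, indicator_of_notMem h]; simpa using ht.le

/-- `e_k` as an element of `H`. -/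
def e (k : ℕ) : H := (memLp_eFun k).toLp (eFun k)

/-- `χ` as an element of `H`. -/
def chi : H := memLp_chiFun.toLp chiFun

/-- `κ` as an element of `H`. -/
def kappa : H := memLp_kappaFun.toLp kappaFun

/-- `f` is of the type `f(t) = lam * t + φ(t)`, where `φ` has the constant value `a j` on each
interval `[j, j + 1)`, and `a 0 = 0`. -/
def HasForm (f : H) (lam : ℂ) (a : ℕ → ℂ) : Prop :=
  a 0 = 0 ∧ ∀ᵐ t ∂weight, f t = lam * (t : ℂ) + a ⌊t⌋₊

/-- `λ = ⟨f, κ⟩`, the coefficient of `t` in `f` for `f` in `D`. -/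
def slope (f : H) : ℂ := inner ℂ kappa f

/-- `h = f - λ e₁`. -/
def stepPart (f : H) : H := f - slope f • e 1

/-- The value of a step function `h` on `[n, n + 1)`. Elements of `H` are classes of functions
modulo null sets, so this value is read off as the mean of `h` over this interval of length `1`. -/
def stepValue (h : H) (n : ℕ) : ℂ := ∫ t in Ico (n : ℝ) (n + 1), h t

/-- `u(n; f) = -λ + h(n) - h(n - 1)`, for `n ≥ 1`. -/
def u (f : H) (n : ℕ) : ℂ :=
  -slope f + stepValue (stepPart f) n - stepValue (stepPart f) (n - 1)

lemma ae_weight_of_ae_restrict {p : ℝ → Prop}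
    (h : ∀ᵐ t ∂(volume.restrict (Ioi (0 : ℝ))), p t) : ∀ᵐ t ∂weight, p t :=
  (withDensity_absolutelyContinuous _ _).ae_le h

lemma ae_restrict_of_ae_weight {p : ℝ → Prop}
    (h : ∀ᵐ t ∂weight, p t) : ∀ᵐ t ∂(volume.restrict (Ioi (0 : ℝ))), p t := by
  rw [weight, ae_withDensity_iff (by fun_prop)] at h
  filter_upwards [h, ae_restrict_mem measurableSet_Ioi] with t ht h0
  refine ht ?_
  have h0' : (0 : ℝ) < t := h0
  have : 0 < 1 / t ^ 2 := by positivity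
  simpa using this.ne'

/-- For `f` of the type `λ t + φ(t)`, `⟨f, κ⟩ = λ`. -/
lemma slope_eq {f : H} {lam : ℂ} {a : ℕ → ℂ} (hf : HasForm f lam a) : slope f = lam := by
  have h1 : slope f = ∫ t, (Ioo (0 : ℝ) 1).indicator (fun t => lam * (t : ℂ) ^ 2) t ∂weight := by
    rw [slope, L2.inner_def]
    refine integral_congr_ae ?_
    filter_upwards [hf.2, memLp_kappaFun.coeFn_toLp] with t h2 h3
    rw [kappa, h3, h2, kappaFun]
    by_cases h : t ∈ Ioo (0 : ℝ) 1
    · have h4 : ⌊t⌋₊ = 0 := Nat.floor_eq_zero.mpr h.2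
      simp only [indicator_of_mem h, h4, hf.1, RCLike.inner_apply, Complex.conj_ofReal]
      ring
    · simp [indicator_of_notMem h]
  have hd : Measurable (fun t : ℝ => ENNReal.ofReal (1 / t ^ 2)) := by fun_prop
  rw [h1, weight, integral_withDensity_eq_integral_toReal_smul hd (by simp)]
  have h2 : ∫ t in Ioi (0 : ℝ), (ENNReal.ofReal (1 / t ^ 2)).toReal •
      (Ioo (0 : ℝ) 1).indicator (fun t => lam * (t : ℂ) ^ 2) t
      = ∫ t in Ioi (0 : ℝ), (Ioo (0 : ℝ) 1).indicator (fun _ => lam) t := by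
    refine setIntegral_congr_fun measurableSet_Ioi fun t ht => ?_
    have ht0 : (t : ℂ) ≠ 0 := by exact_mod_cast (ne_of_gt ht)
    by_cases h : t ∈ Ioo (0 : ℝ) 1
    · simp only [indicator_of_mem h]
      rw [ENNReal.toReal_ofReal (by positivity), Complex.real_smul]
      push_cast
      field_simp
    · simp [indicator_of_notMem h]
  rw [h2, setIntegral_indicator measurableSet_Ioo,
    inter_eq_self_of_subset_right (fun t ht => ht.1)]
  simp

/-- For `f` of the type `λ t + φ(t)`, the function `h = f - λ e₁` takes the value `λ n + φ(n)` on
`[n, n + 1)`. -/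
lemma stepValue_stepPart_eq {f : H} {lam : ℂ} {a : ℕ → ℂ} (hf : HasForm f lam a) (n : ℕ) :
    stepValue (stepPart f) n = lam * n + a n := by
  have h1 : ∀ᵐ t ∂weight, stepPart f t = lam * (t : ℂ) + a ⌊t⌋₊ - lam * (Int.fract t : ℝ) := by
    rw [stepPart, slope_eq hf]
    filter_upwards [Lp.coeFn_sub f (lam • e 1), Lp.coeFn_smul lam (e 1), hf.2,
      (memLp_eFun 1).coeFn_toLp] with t h2 h3 h4 h5
    rw [h2, Pi.sub_apply, h3, Pi.smul_apply, h4, e, h5]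
    simp [eFun]
  have h2 : ∀ᵐ t ∂(volume.restrict (Ico (n : ℝ) (n + 1))),
      stepPart f t = lam * n + a n := by
    rw [← restrict_Ioo_eq_restrict_Ico]
    have hsub : Ioo (n : ℝ) (n + 1) ⊆ Ioi 0 := fun t ht =>
      lt_of_le_of_lt (Nat.cast_nonneg n) ht.1
    filter_upwards [ae_restrict_of_ae_restrict_of_subset hsub (ae_restrict_of_ae_weight h1),
      ae_restrict_mem measurableSet_Ioo] with t h3 h4
    have h5 : ⌊t⌋₊ = n :=
      (Nat.floor_eq_iff ((Nat.cast_nonneg n).trans h4.1.le)).mpr ⟨h4.1.le, h4.2⟩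
    have h6 : ⌊t⌋ = (n : ℤ) := Int.floor_eq_iff.mpr ⟨by exact_mod_cast h4.1.le, by
      exact_mod_cast h4.2⟩
    rw [h3, h5, Int.fract, h6]
    push_cast
    ring
  rw [stepValue, integral_congr_ae h2]
  simp

/-- For `f` of the type `λ t + φ(t)`, `u(n; f) = φ(n) - φ(n - 1)`, that is,
`φ(t) = ∑_{n ≤ t} u(n; f)`. -/
lemma u_eq {f : H} {lam : ℂ} {a : ℕ → ℂ} (hf : HasForm f lam a) {n : ℕ} (hn : 1 ≤ n) :
    u f n = a n - a (n - 1) := by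
  rw [u, slope_eq hf, stepValue_stepPart_eq hf, stepValue_stepPart_eq hf, Nat.cast_sub hn]
  push_cast
  ring

/-- `w(n; f) = ∑_{d ∣ n} μ(n / d) u(d; f)`, for `n ≥ 1`. -/
def w (f : H) (n : ℕ) : ℂ :=
  ∑ d ∈ n.divisors, (ArithmeticFunction.moebius (n / d) : ℂ) * u f d

/-- `B = Vect(e_n, n ≥ 1)`. -/
def B : Submodule ℂ H := Submodule.span ℂ (e '' {n | 1 ≤ n})

/-- `B₀ = Vect(e_n - e_1 / n, n ≥ 2)`. -/
def B₀ : Submodule ℂ H :=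
  Submodule.span ℂ ((fun n : ℕ => e n - (1 / (n : ℂ)) • e 1) '' {n | 2 ≤ n})

/-- The orthogonal projection of `χ` on the closure of `B`. -/
def chiTilde : H := B.topologicalClosure.starProjection chi

/-- The orthogonal projection of `χ` on the closure of `B₀`. -/
def chiTilde₀ : H := B₀.topologicalClosure.starProjection chi

/-- `ν(n) = w(n; χ̃)`. -/
def nu (n : ℕ) : ℂ := w chiTilde n

/-- `ν₀(n) = w(n; χ̃₀)`. -/
def nu₀ (n : ℕ) : ℂ := w chiTilde₀ n

end BaezDuarte

end

/-!
Elements of the closure of `B` have the form `λ t + φ(t)`, and `w(n; f)` determines `φ` by Möbius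
inversion. If `w(n; f) = μ(n)` for all `n ≥ 2`, then `φ(n) = 1 + c n` for `n ≥ 1`; since a function
of linear growth is not in `H`, each of the two assertions about `ν` and `ν₀` says that `χ` equals
its projection, that is, `χ ∈ closure B` (`forall_nu_iff`, `forall_nu₀_iff`,
`chi_mem_closure_B₀_iff`). What remains is the criterion of Nyman, Beurling and Báez-Duarte:
`χ ∈ closure B` if and only if the Riemann hypothesis holds. It rests on the Mellin transforms
`∫ {t / k} t^(-s-1) dt = -k^(-s) ζ(s) / s` for `0 < Re s < 1` and `∫ χ(t) t^(-s-1) dt = 1 / s`.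

If `ζ(s) = 0` with `1/2 < Re s < 1`, the functional `f ↦ ∫₁^∞ f(t) t^(-s-1) dt` is continuous on
`H`, vanishes on `B₀` and not at `χ` (`riemannZeta_ne_zero_of_chi_mem`).

Conversely, assume the Riemann hypothesis. The Mellin transform on the critical line is an isometry
from `H` to `L²(ℝ)`, so let `g ∈ L²(ℝ)` be orthogonal to the functions `k^(-s) ζ(s) / s`, `k ≥ 1`;
it has to be shown that `g` is orthogonal to `1 / s`. For `Re w > 1/2` the function
`ζ(s) / (s ζ(s + w)) = ∑ μ(k) k^(-w) k^(-s) ζ(s) / s` is orthogonal to `g`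
(`integral_quotKernel_eq_zero_of_re`). The inner product is analytic in `w` near the real interval
`(0, 3/4)`, so it vanishes there (`integral_quotKernel_eq_zero`), and `w → 0+` gives the claim
(`inner_mellinIsometry_chi`).

The analytic input is that `ζ(s) / (s ζ(s + w))` is dominated by a fixed square integrable function,
for real `w ∈ (0, 3/4]` uniformly, and for complex `w` locally. For real `w = u` let `ξ` be the
completed zeta function. On the line `Re s = (1 - u) / 2` the functional equation gives
`|ξ(s)| = |ξ(s + u)|`, and the Phragmén–Lindelöf principle extends the bound `|ξ(s)| ≪ |ξ(s + u)|`
to the critical line (`exists_norm_xi_le`); a Stirling type bound for quotients of Gamma values then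
yields `|ζ(s) / ζ(s + u)| ≪ |s|^(u/2)` (`exists_norm_zetaReg_le`). The growth condition of the
Phragmén–Lindelöf principle and the passage to complex `w` follow from the Borel–Carathéodory
theorem, applied to the logarithm of `(s - 1) ζ(s)` on discs in `Re s > 1/2`
(`exists_rpow_le_norm_zetaReg`, `exists_zetaReg_comparison`).
-/

/-! ### Functions of the form `λ t + φ(t)` and the reduction to `χ ∈ closure B` -/

namespace BaezDuarte

open Filter Topology

lemma HasForm.add {f g : H} {l m : ℂ} {a b : ℕ → ℂ} (hf : HasForm f l a) (hg : HasForm g m b) :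
    HasForm (f + g) (l + m) (a + b) := by
  refine ⟨by simp [hf.1, hg.1], ?_⟩
  filter_upwards [Lp.coeFn_add f g, hf.2, hg.2] with t h1 h2 h3
  rw [h1, Pi.add_apply, h2, h3, Pi.add_apply]
  ring

lemma HasForm.smul {f : H} {l : ℂ} {a : ℕ → ℂ} (c : ℂ) (hf : HasForm f l a) :
    HasForm (c • f) (c * l) (c • a) := by
  refine ⟨by simp [hf.1], ?_⟩
  filter_upwards [Lp.coeFn_smul c f, hf.2] with t h1 h2
  rw [h1, Pi.smul_apply, h2, Pi.smul_apply, smul_eq_mul, smul_eq_mul]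
  ring

lemma HasForm.zero : HasForm 0 0 0 := by
  refine ⟨rfl, ?_⟩
  filter_upwards [Lp.coeFn_zero ℂ 2 weight] with t h1
  rw [h1]
  simp

lemma ae_weight_pos : ∀ᵐ t ∂weight, 0 < t :=
  ae_weight_of_ae_restrict (ae_restrict_mem measurableSet_Ioi)

/-- `{t / k} = t / k - ⌊⌊t⌋ / k⌋`. -/
lemma HasForm.e (k : ℕ) :
    HasForm (e k) (1 / (k : ℂ)) (fun j => -((j / k : ℕ) : ℂ)) := by
  refine ⟨by simp, ?_⟩
  filter_upwards [(memLp_eFun k).coeFn_toLp, ae_weight_pos] with t h1 h2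
  rw [BaezDuarte.e, h1, eFun, ← Nat.floor_div_natCast, Int.fract,
    ← natCast_floor_eq_intCast_floor (by positivity)]
  push_cast
  ring

lemma HasForm.chi : HasForm chi 0 (fun j => if 1 ≤ j then 1 else 0) := by
  refine ⟨by simp, ?_⟩
  filter_upwards [memLp_chiFun.coeFn_toLp, ae_weight_pos] with t h1 h2
  rw [BaezDuarte.chi, h1, chiFun, indicator_apply]
  simp [Nat.one_le_floor_iff]

lemma exists_hasForm_of_mem_B {f : H} (hf : f ∈ B) : ∃ l a, HasForm f l a := by
  induction hf using Submodule.span_induction with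
  | mem x hx => obtain ⟨k, -, rfl⟩ := hx; exact ⟨_, _, HasForm.e k⟩
  | zero => exact ⟨_, _, HasForm.zero⟩
  | add x y _ _ hx hy =>
    obtain ⟨l, a, h⟩ := hx
    obtain ⟨m, b, h'⟩ := hy
    exact ⟨_, _, h.add h'⟩
  | smul c x _ hx =>
    obtain ⟨l, a, h⟩ := hx
    exact ⟨_, _, h.smul c⟩

lemma continuous_slope : Continuous slope := by
  unfold slope
  fun_prop

/-- The space `D` is closed: along a sequence converging almost everywhere the slopes converge,
hence so do the values of the step functions. -/
lemma exists_hasForm_of_mem_closure {f : H} (hf : f ∈ B.topologicalClosure) :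
    ∃ l a, HasForm f l a := by
  rw [← SetLike.mem_coe, Submodule.topologicalClosure_coe, mem_closure_iff_seq_limit] at hf
  obtain ⟨F, hF, hlim⟩ := hf
  choose l a hla using fun n => exists_hasForm_of_mem_B (hF n)
  obtain ⟨ns, hns, hae⟩ := (tendstoInMeasure_of_tendsto_Lp hlim).exists_seq_tendsto_ae
  have hl : Tendsto (fun n => l (ns n)) atTop (𝓝 (slope f)) := by
    have := ((continuous_slope.tendsto f).comp hlim).comp hns.tendsto_atTop
    refine this.congr fun n => ?_
    simp [slope_eq (hla _)]
  have hall : ∀ᵐ t ∂weight, Tendsto (fun n => a (ns n) ⌊t⌋₊) atTop (𝓝 (f t - slope f * t)) := by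
    have h2 : ∀ᵐ t ∂weight, ∀ n, F n t = l n * t + a n ⌊t⌋₊ :=
      ae_all_iff.mpr fun n => (hla n).2
    filter_upwards [hae, h2] with t h3 h4
    refine (h3.sub (hl.mul_const (t : ℂ))).congr fun n => ?_
    rw [h4]
    ring
  have hex : ∀ j : ℕ, ∃ c, Tendsto (fun n => a (ns n) j) atTop (𝓝 c) := by
    intro j
    have hpos : (volume.restrict (Ioo (j : ℝ) (j + 1))) ≠ 0 := by
      simp
    have hsub : Ioo (j : ℝ) (j + 1) ⊆ Ioi 0 := fun t ht =>
      lt_of_le_of_lt (Nat.cast_nonneg j) ht.1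
    have h3 := ae_restrict_of_ae_restrict_of_subset hsub (ae_restrict_of_ae_weight hall)
    have : (ae (volume.restrict (Ioo (j : ℝ) (j + 1)))).NeBot := ae_neBot.mpr hpos
    obtain ⟨t, ht, htj⟩ := (h3.and (ae_restrict_mem measurableSet_Ioo)).exists
    have h5 : ⌊t⌋₊ = j :=
      (Nat.floor_eq_iff ((Nat.cast_nonneg j).trans htj.1.le)).mpr ⟨htj.1.le, htj.2⟩
    exact ⟨_, h5 ▸ ht⟩
  choose c hc using hex
  refine ⟨slope f, c, ?_, ?_⟩
  · exact tendsto_nhds_unique (hc 0) (by simp [(hla _).1])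
  · filter_upwards [hall] with t ht
    rw [tendsto_nhds_unique (hc ⌊t⌋₊) ht]
    ring

/-- A function which grows linearly is not in `H`. -/
lemma eq_zero_of_mul_le_norm {f : H} {c : ℝ} (hc : 0 ≤ c)
    (h : ∀ᵐ t ∂weight, 1 ≤ t → c * t ≤ ‖f t‖) : c = 0 := by
  by_contra hne
  have hcpos : 0 < c := lt_of_le_of_ne hc (Ne.symm hne)
  have h1 := (memLp_two_iff_integrable_sq_norm (Lp.aestronglyMeasurable f)).mp (Lp.memLp f)
  generalize (f : ℝ → ℂ) = g at h h1
  rw [weight, integrable_withDensity_iff_integrable_smul' (by fun_prop) (by simp)] at h1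
  have h2 : IntegrableOn (fun _ : ℝ => c ^ 2) (Ioi (1 : ℝ)) := by
    refine Integrable.mono' (h1.mono_measure (Measure.restrict_mono
      (Ioi_subset_Ioi zero_le_one) le_rfl)) (by fun_prop) ?_
    have h3 := ae_restrict_of_ae_restrict_of_subset (Ioi_subset_Ioi (zero_le_one' ℝ))
      (ae_restrict_of_ae_weight h)
    filter_upwards [h3, ae_restrict_mem measurableSet_Ioi] with t ht ht1
    have ht1' : (1 : ℝ) < t := ht1
    have ht0 : 0 < t := by linarith
    have h4 := ht ht1'.le
    rw [ENNReal.toReal_ofReal (by positivity), Real.norm_of_nonneg (by positivity), smul_eq_mul,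
      div_mul_eq_mul_div, one_mul, le_div_iff₀ (by positivity), ← mul_pow]
    gcongr
  rw [integrableOn_const_iff (by simp)] at h2
  simp [hne] at h2

lemma B₀_le_B : B₀ ≤ B := by
  refine Submodule.span_le.mpr ?_
  rintro _ ⟨n, hn, rfl⟩
  have hn' : 1 ≤ n := le_trans one_le_two hn
  exact B.sub_mem (Submodule.subset_span ⟨n, hn', rfl⟩)
    (B.smul_mem _ (Submodule.subset_span ⟨1, le_refl 1, rfl⟩))

/-- The combination `∑ c_k e_k - (∑ c_k / k) e₁` equals `∑ c_k (e_k - e₁ / k)`. -/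
lemma sub_slope_mem_B₀ {f : H} (hf : f ∈ B) : f - slope f • e 1 ∈ B₀ := by
  have hs : ∀ k, slope (e k) = 1 / (k : ℂ) := fun k => slope_eq (HasForm.e k)
  induction hf using Submodule.span_induction with
  | mem x hx =>
    obtain ⟨k, hk, rfl⟩ := hx
    rw [hs]
    rcases eq_or_ne k 1 with rfl | hk1
    · simp
    · have h2 : 2 ≤ k := by
        have : 1 ≤ k := hk
        omega
      exact Submodule.subset_span ⟨k, h2, rfl⟩
  | zero => simp [slope]
  | add x y _ _ hx hy =>
    have : slope (x + y) = slope x + slope y := by simp [slope, inner_add_right]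
    rw [this, add_smul, add_sub_add_comm]
    exact B₀.add_mem hx hy
  | smul c x _ hx =>
    have : slope (c • x) = c * slope x := by simp [slope, inner_smul_right]
    rw [this, mul_smul, ← smul_sub]
    exact B₀.smul_mem _ hx

/-- `f ↦ f - λ e₁` maps the closure of `B` to the closure of `B₀`. -/
lemma sub_slope_mem_closure {f : H} (hf : f ∈ B.topologicalClosure) :
    f - slope f • e 1 ∈ B₀.topologicalClosure := by
  rw [← SetLike.mem_coe, Submodule.topologicalClosure_coe] at hf ⊢
  have hcont : Continuous fun f : H => f - slope f • e 1 :=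
    continuous_id.sub (continuous_slope.smul continuous_const)
  exact map_mem_closure (f := fun f : H => f - slope f • e 1) hcont hf
    fun x hx => sub_slope_mem_B₀ hx

lemma chi_mem_closure_B₀_iff :
    chi ∈ B₀.topologicalClosure ↔ chi ∈ B.topologicalClosure := by
  refine ⟨fun h => Submodule.topologicalClosure_mono B₀_le_B h, fun h => ?_⟩
  have := sub_slope_mem_closure h
  rwa [slope_eq HasForm.chi, zero_smul, sub_zero] at this

lemma slope_eq_zero_of_mem_closure_B₀ {f : H} (hf : f ∈ B₀.topologicalClosure) :
    slope f = 0 := by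
  rw [← SetLike.mem_coe, Submodule.topologicalClosure_coe] at hf
  refine closure_minimal (s := (B₀ : Set H)) (t := {f | slope f = 0}) ?_
    (isClosed_eq continuous_slope continuous_const) hf
  intro g hg
  simp only [mem_ofPred_eq]
  induction hg using Submodule.span_induction with
  | mem x hx =>
    obtain ⟨k, hk, rfl⟩ := hx
    simp only [slope, inner_sub_right, inner_smul_right]
    have h1 := slope_eq (HasForm.e k)
    have h2 := slope_eq (HasForm.e 1)
    rw [slope] at h1 h2
    rw [h1, h2]
    simp
  | zero => simp [slope]
  | add x y _ _ hx hy =>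
    rw [slope] at hx hy ⊢
    rw [inner_add_right, hx, hy, add_zero]
  | smul c x _ hx =>
    rw [slope] at hx ⊢
    rw [inner_smul_right, hx, mul_zero]

lemma w_chi {n : ℕ} (hn : 1 ≤ n) : w chi n = (ArithmeticFunction.moebius n : ℂ) := by
  rw [w, Finset.sum_eq_single 1]
  · rw [u_eq HasForm.chi le_rfl]
    simp
  · intro d hd hd1
    have hd0 : 1 ≤ d := Nat.pos_of_mem_divisors hd
    rw [u_eq HasForm.chi hd0, if_pos hd0, if_pos (by omega)]
    simp
  · intro h
    exact absurd (Nat.one_mem_divisors.mpr (by omega)) h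

/-- Möbius inversion of the definition of `w`. -/
lemma sum_w (f : H) {n : ℕ} (hn : 0 < n) : ∑ d ∈ n.divisors, w f d = u f n := by
  refine (ArithmeticFunction.sum_eq_iff_sum_mul_moebius_eq (f := w f) (g := u f)).mpr ?_ n hn
  intro m hm
  rw [w, ← Nat.map_div_left_divisors, Finset.sum_map]
  rfl

lemma sum_moebius_divisors (n : ℕ) :
    ∑ d ∈ n.divisors, (ArithmeticFunction.moebius d : ℂ) = if n = 1 then 1 else 0 := by
  have h := congrArg (fun F : ArithmeticFunction ℤ => F n)
    ArithmeticFunction.moebius_mul_coe_zeta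
  rw [ArithmeticFunction.coe_mul_zeta_apply, ArithmeticFunction.one_apply] at h
  rw [← Int.cast_sum, h]
  split_ifs <;> simp

/-- If `w(n; f) = μ(n)` for all `n ≥ 2`, then `φ(n) = 1 + (w(1; f) - 1) n` for `n ≥ 1`. -/
lemma HasForm.eq_of_w_eq_moebius {f : H} {l : ℂ} {a : ℕ → ℂ} (hf : HasForm f l a)
    (h : ∀ n, 2 ≤ n → w f n = (ArithmeticFunction.moebius n : ℂ)) {n : ℕ} (hn : 1 ≤ n) :
    a n = 1 + (w f 1 - 1) * n := by
  have hu : ∀ m : ℕ, 1 ≤ m → a m - a (m - 1) = (w f 1 - 1) + if m = 1 then 1 else 0 := by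
    intro m hm
    rw [← u_eq hf hm, ← sum_w f hm, ← sum_moebius_divisors m]
    have h1 : (1 : ℕ) ∈ m.divisors := Nat.one_mem_divisors.mpr (by omega)
    rw [← Finset.add_sum_erase _ _ h1, ← Finset.add_sum_erase _ _ h1]
    have h2 : ∑ x ∈ m.divisors.erase 1, w f x
        = ∑ x ∈ m.divisors.erase 1, (ArithmeticFunction.moebius x : ℂ) := by
      refine Finset.sum_congr rfl fun d hd => h d ?_
      obtain ⟨h3, h4⟩ := Finset.mem_erase.mp hd
      have := Nat.pos_of_mem_divisors h4
      omega
    rw [h2]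
    simp
    ring
  induction n, hn using Nat.le_induction with
  | base =>
    have := hu 1 le_rfl
    simp only [Nat.sub_self, hf.1] at this
    simp at this ⊢
    rw [this]
  | succ n hn ih =>
    have := hu (n + 1) (by omega)
    rw [Nat.add_sub_cancel, ih, if_neg (by omega)] at this
    push_cast
    linear_combination this

lemma mem_of_starProjection_eq {K : Submodule ℂ H} [K.HasOrthogonalProjection] {v : H}
    (h : K.starProjection v = v) : v ∈ K :=
  h ▸ K.starProjection_apply_mem v

theorem forall_nu_iff :
    (∀ n : ℕ, 1 ≤ n → nu n = (ArithmeticFunction.moebius n : ℂ)) ↔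
      chi ∈ B.topologicalClosure := by
  constructor
  · intro h
    obtain ⟨l, a, hf⟩ := exists_hasForm_of_mem_closure
      (B.topologicalClosure.starProjection_apply_mem chi)
    change HasForm chiTilde l a at hf
    have ha : ∀ n, 1 ≤ n → a n = 1 := by
      intro n hn
      have h1 : w chiTilde 1 = 1 := by simpa [nu] using h 1 le_rfl
      rw [hf.eq_of_w_eq_moebius (fun m hm => h m (by omega)) hn, h1]
      ring
    have hg := hf.add (HasForm.chi.smul (-1))
    have hae : ∀ᵐ t ∂weight, (chiTilde + (-1 : ℂ) • chi) t = l * t := by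
      filter_upwards [hg.2, ae_weight_pos] with t ht ht0
      rw [ht]
      rcases Nat.eq_zero_or_pos ⌊t⌋₊ with h0 | h0
      · simp [h0, hf.1]
      · simp [ha _ h0, Nat.one_le_iff_ne_zero, h0.ne']
    have hl : ‖l‖ = 0 := by
      refine eq_zero_of_mul_le_norm (norm_nonneg l) (f := chiTilde + (-1 : ℂ) • chi) ?_
      filter_upwards [hae] with t ht ht1
      rw [ht, norm_mul, Complex.norm_real, Real.norm_of_nonneg (by linarith)]
    rw [norm_eq_zero] at hl
    have hz : chiTilde + (-1 : ℂ) • chi = 0 := by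
      refine Lp.ext ?_
      filter_upwards [hae, Lp.coeFn_zero ℂ 2 weight] with t ht h0
      rw [ht, h0, hl]
      simp
    refine mem_of_starProjection_eq ?_
    rw [neg_one_smul, ← sub_eq_add_neg, sub_eq_zero] at hz
    exact hz
  · intro h n hn
    have : chiTilde = chi := Submodule.starProjection_eq_self_iff.mpr h
    rw [nu, this, w_chi hn]

theorem forall_nu₀_iff :
    (∀ n : ℕ, 2 ≤ n → nu₀ n = (ArithmeticFunction.moebius n : ℂ)) ↔
      chi ∈ B₀.topologicalClosure := by
  constructor
  · intro h
    have hmem := B₀.topologicalClosure.starProjection_apply_mem chi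
    change chiTilde₀ ∈ _ at hmem
    obtain ⟨l, a, hf⟩ := exists_hasForm_of_mem_closure
      (Submodule.topologicalClosure_mono B₀_le_B hmem)
    have hl : l = 0 := by
      rw [← slope_eq hf]
      exact slope_eq_zero_of_mem_closure_B₀ hmem
    set c := w chiTilde₀ 1 - 1 with hc
    have ha : ∀ n, 1 ≤ n → a n = 1 + c * n := fun n hn => hf.eq_of_w_eq_moebius h hn
    have hg := hf.add (HasForm.chi.smul (-1))
    have hae : ∀ᵐ t ∂weight, (chiTilde₀ + (-1 : ℂ) • chi) t = c * (⌊t⌋₊ : ℂ) := by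
      filter_upwards [hg.2, ae_weight_pos] with t ht ht0
      rw [ht]
      rcases Nat.eq_zero_or_pos ⌊t⌋₊ with h0 | h0
      · simp [h0, hf.1, hl]
      · simp [ha _ h0, Nat.one_le_iff_ne_zero, h0.ne', hl]
    have hc0 : ‖c‖ / 2 = 0 := by
      refine eq_zero_of_mul_le_norm (by positivity) (f := chiTilde₀ + (-1 : ℂ) • chi) ?_
      filter_upwards [hae] with t ht ht1
      rw [ht, norm_mul, Complex.norm_natCast]
      have h1 : (1 : ℝ) ≤ ⌊t⌋₊ := by exact_mod_cast (Nat.one_le_floor_iff t).mpr ht1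
      have h2 := Nat.lt_floor_add_one t
      have h3 : t / 2 ≤ ⌊t⌋₊ := by linarith
      calc ‖c‖ / 2 * t = ‖c‖ * (t / 2) := by ring
        _ ≤ _ := by gcongr
    have hc1 : c = 0 := by
      rw [← norm_eq_zero]
      linarith
    have hz : chiTilde₀ + (-1 : ℂ) • chi = 0 := by
      refine Lp.ext ?_
      filter_upwards [hae, Lp.coeFn_zero ℂ 2 weight] with t ht h0
      rw [ht, h0, hc1]
      simp
    refine mem_of_starProjection_eq ?_
    rw [neg_one_smul, ← sub_eq_add_neg, sub_eq_zero] at hz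
    exact hz
  · intro h n hn
    have : chiTilde₀ = chi := Submodule.starProjection_eq_self_iff.mpr h
    rw [nu₀, this, w_chi (by omega)]

end BaezDuarte

/-! ### The zeta function in `Re s > 0` and the Mellin transform of `{t / k}` -/

namespace BaezDuarte

open Filter Topology Complex

/-- An integral depending on a complex parameter is holomorphic if the integrand is holomorphic in
the parameter and dominated. -/
lemma differentiableOn_integral_of_dominated {α : Type*} [MeasurableSpace α] {μ : Measure α}
    {U : Set ℂ} (hU : IsOpen U) {F : ℂ → α → ℂ} {bound : α → ℝ}
    (hmeas : ∀ z ∈ U, AEStronglyMeasurable (F z) μ)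
    (hdiff : ∀ a, DifferentiableOn ℂ (fun z => F z a) U)
    (hbound : ∀ᵐ a ∂μ, ∀ z ∈ U, ‖F z a‖ ≤ bound a) (hint : Integrable bound μ) :
    DifferentiableOn ℂ (fun z => ∫ a, F z a ∂μ) U := by
  intro z₀ hz₀
  obtain ⟨r, hr, hball⟩ := Metric.isOpen_iff.mp hU z₀ hz₀
  have hsub : Metric.ball z₀ (r / 2) ⊆ U :=
    (Metric.ball_subset_ball (by linarith)).trans hball
  have hderiv : ∀ a, ∀ z ∈ U, HasDerivAt (fun z => F z a) (deriv (fun z => F z a) z) z :=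
    fun a z hz => ((hdiff a).differentiableAt (hU.mem_nhds hz)).hasDerivAt
  -- the derivative is the limit of a sequence of difference quotients, hence measurable
  have hmeas' : AEStronglyMeasurable (fun a => deriv (fun z => F z a) z₀) μ := by
    have hh : Tendsto (fun n : ℕ => ((r / 2 / (n + 1) : ℝ) : ℂ)) atTop (𝓝[≠] 0) := by
      refine tendsto_nhdsWithin_iff.mpr ⟨?_, Eventually.of_forall fun n => ?_⟩
      · have h1 : Tendsto (fun n : ℕ => r / 2 / ((n : ℝ) + 1)) atTop (𝓝 0) :=
          tendsto_const_nhds.div_atTop (tendsto_atTop_add_const_right _ _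
            tendsto_natCast_atTop_atTop)
        exact_mod_cast (continuous_ofReal.tendsto 0).comp h1
      · have : r / 2 / ((n : ℝ) + 1) ≠ 0 := by positivity
        exact ofReal_ne_zero.mpr this
    have hmem : ∀ n : ℕ, z₀ + ((r / 2 / (n + 1) : ℝ) : ℂ) ∈ U := by
      intro n
      refine hball ?_
      rw [Metric.mem_ball, dist_eq_norm, add_sub_cancel_left, norm_real,
        Real.norm_of_nonneg (by positivity), div_lt_iff₀ (by positivity)]
      have : (0 : ℝ) ≤ n := Nat.cast_nonneg n
      nlinarith
    refine aestronglyMeasurable_of_tendsto_ae (u := atTop)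
      (f := fun (n : ℕ) a => ((r / 2 / (n + 1) : ℝ) : ℂ)⁻¹ •
        (F (z₀ + ((r / 2 / (n + 1) : ℝ) : ℂ)) a - F z₀ a)) ?_ ?_
    · intro n
      exact ((hmeas _ (hmem n)).sub (hmeas _ hz₀)).const_smul
        (((r / 2 / (n + 1) : ℝ) : ℂ)⁻¹)
    · refine Eventually.of_forall fun a => ?_
      exact (hasDerivAt_iff_tendsto_slope_zero.mp (hderiv a z₀ hz₀)).comp hh
  refine (hasDerivAt_integral_of_dominated_loc_of_deriv_le (μ := μ)
    (F := F) (F' := fun z a => deriv (fun z => F z a) z)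
    (bound := fun a => bound a / (r / 2)) (s := Metric.ball z₀ (r / 2))
    (Metric.ball_mem_nhds _ (by positivity)) ?_ ?_ hmeas' ?_ (hint.div_const _) ?_).2
    |>.differentiableAt.differentiableWithinAt
  · filter_upwards [hU.mem_nhds hz₀] with z hz using hmeas z hz
  · refine Integrable.mono' hint (hmeas _ hz₀) ?_
    filter_upwards [hbound] with a ha using ha _ hz₀
  · filter_upwards [hbound] with a ha z hz
    have hsub' : Metric.closedBall z (r / 2) ⊆ U := fun y hy => hball <| by
      have h1 := Metric.mem_closedBall.mp hy
      have h2 := Metric.mem_ball.mp hz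
      have := dist_triangle y z z₀
      exact Metric.mem_ball.mpr (by linarith)
    refine norm_deriv_le_of_forall_mem_sphere_norm_le (by positivity) ?_ fun y hy =>
      ha y (hsub' (Metric.sphere_subset_closedBall hy))
    exact ((hdiff a).mono (by rwa [closure_ball _ (by positivity)])).diffContOnCl
  · exact Eventually.of_forall fun a z hz => hderiv a z (hsub hz)

/-- The entire function `s (s - 1) π^(-s/2) Γ(s/2) ζ(s)`. -/
noncomputable def xi (s : ℂ) : ℂ := s * (s - 1) * completedRiemannZeta₀ s + 1

lemma differentiable_xi : Differentiable ℂ xi :=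
  ((differentiable_id.mul (differentiable_id.sub_const 1)).mul
    differentiable_completedZeta₀).add_const 1

lemma xi_one_sub (s : ℂ) : xi (1 - s) = xi s := by
  rw [xi, xi, completedRiemannZeta₀_one_sub]
  ring

lemma Gammaℝ_ne_zero {s : ℂ} (hs : 0 < s.re) : Gammaℝ s ≠ 0 := Gammaℝ_ne_zero_of_re_pos hs

lemma ne_zero_of_re_pos {s : ℂ} (hs : 0 < s.re) : s ≠ 0 := by
  rintro rfl
  simp at hs

lemma xi_eq {s : ℂ} (hs : 0 < s.re) (hs1 : s ≠ 1) :
    xi s = s * Gammaℝ s * ((s - 1) * riemannZeta s) := by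
  have h0 := ne_zero_of_re_pos hs
  have h1 : s - 1 ≠ 0 := sub_ne_zero.mpr hs1
  have h2 : 1 - s ≠ 0 := sub_ne_zero.mpr hs1.symm
  have h3 := Gammaℝ_ne_zero hs
  rw [riemannZeta_def_of_ne_zero h0, completedRiemannZeta_eq, xi]
  field_simp
  ring

/-- The function `(s - 1) ζ(s)`, with the singularity at `s = 1` removed, for `Re s > 0`. -/
noncomputable def zetaReg (s : ℂ) : ℂ := xi s / (s * Gammaℝ s)

lemma zetaReg_eq {s : ℂ} (hs : 0 < s.re) (hs1 : s ≠ 1) :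
    zetaReg s = (s - 1) * riemannZeta s := by
  rw [zetaReg, xi_eq hs hs1,
    mul_div_cancel_left₀ _ (mul_ne_zero (ne_zero_of_re_pos hs) (Gammaℝ_ne_zero hs))]

lemma zetaReg_one : zetaReg 1 = 1 := by
  simp [zetaReg, xi, Gammaℝ_one]

lemma xi_eq_zetaReg {s : ℂ} (hs : 0 < s.re) : xi s = s * Gammaℝ s * zetaReg s := by
  rw [zetaReg, mul_div_cancel₀ _ (mul_ne_zero (ne_zero_of_re_pos hs) (Gammaℝ_ne_zero hs))]

lemma isOpen_re_gt (a : ℝ) : IsOpen {s : ℂ | a < s.re} :=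
  isOpen_lt continuous_const continuous_re

lemma differentiableOn_zetaReg : DifferentiableOn ℂ zetaReg {s | 0 < s.re} := by
  have h : ∀ s : ℂ, zetaReg s = xi s * s⁻¹ * (Gammaℝ s)⁻¹ := fun s => by
    rw [zetaReg, div_eq_mul_inv, mul_inv, mul_assoc]
  simp_rw [funext h]
  exact (differentiable_xi.differentiableOn.mul (differentiableOn_id.inv
    fun s hs => ne_zero_of_re_pos hs)).mul differentiable_Gammaℝ_inv.differentiableOn

/-- `∫₁^∞ {t} t^(-s-1) dt`, for `Re s > 0`. -/
noncomputable def fractIntegral (s : ℂ) : ℂ :=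
  ∫ t in Ioi (1 : ℝ), ((Int.fract t : ℝ) : ℂ) * (t : ℂ) ^ (-(s + 1))

lemma norm_fract_mul_cpow_le {s : ℂ} {t : ℝ} (ht : 0 < t) :
    ‖((Int.fract t : ℝ) : ℂ) * (t : ℂ) ^ (-(s + 1))‖ ≤ t ^ (-(s.re + 1)) := by
  rw [norm_mul, norm_real, Real.norm_of_nonneg (Int.fract_nonneg t),
    norm_cpow_eq_rpow_re_of_pos ht]
  simp only [neg_re, add_re, one_re]
  exact mul_le_of_le_one_left (by positivity) (Int.fract_lt_one t).le

lemma measurable_fract_mul_cpow (s : ℂ) :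
    Measurable fun t : ℝ => ((Int.fract t : ℝ) : ℂ) * (t : ℂ) ^ (-(s + 1)) := by
  fun_prop

lemma integrableOn_fract_mul_cpow {s : ℂ} (hs : 0 < s.re) :
    IntegrableOn (fun t : ℝ => ((Int.fract t : ℝ) : ℂ) * (t : ℂ) ^ (-(s + 1))) (Ioi 1) := by
  refine Integrable.mono' (integrableOn_Ioi_rpow_of_lt (a := -(s.re + 1)) (by linarith) one_pos)
    (measurable_fract_mul_cpow s).aestronglyMeasurable ?_
  filter_upwards [ae_restrict_mem measurableSet_Ioi] with t ht
  exact norm_fract_mul_cpow_le (one_pos.trans ht)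

lemma norm_fractIntegral_le {s : ℂ} (hs : 0 < s.re) : ‖fractIntegral s‖ ≤ 1 / s.re := by
  have h := norm_integral_le_of_norm_le (μ := volume.restrict (Ioi (1 : ℝ)))
    (integrableOn_Ioi_rpow_of_lt (a := -(s.re + 1)) (by linarith) one_pos)
    (f := fun t : ℝ => ((Int.fract t : ℝ) : ℂ) * (t : ℂ) ^ (-(s + 1)))
    (by
      filter_upwards [ae_restrict_mem measurableSet_Ioi] with t ht
      exact norm_fract_mul_cpow_le (one_pos.trans ht))
  rw [integral_Ioi_rpow_of_lt (by linarith) one_pos, Real.one_rpow] at h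
  refine h.trans_eq ?_
  rw [show -(s.re + 1) + 1 = -s.re by ring, neg_div_neg_eq]

lemma differentiableOn_fractIntegral : DifferentiableOn ℂ fractIntegral {s | 0 < s.re} := by
  intro s hs
  have hs' : 0 < s.re := hs
  have hU := isOpen_re_gt (s.re / 2)
  have hsU : s ∈ {z : ℂ | s.re / 2 < z.re} := by
    simp only [mem_ofPred_eq]
    linarith
  have h := differentiableOn_integral_of_dominated (μ := volume.restrict (Ioi (1 : ℝ))) hU
    (F := fun s t => ((Int.fract t : ℝ) : ℂ) * (t : ℂ) ^ (-(s + 1)))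
    (bound := fun t => t ^ (-(s.re / 2 + 1)))
    (fun z _ => (measurable_fract_mul_cpow z).aestronglyMeasurable) ?_ ?_
    (integrableOn_Ioi_rpow_of_lt (by linarith) one_pos)
  · exact (h.differentiableAt (hU.mem_nhds hsU)).differentiableWithinAt
  · intro t z hz
    have hz' : 0 < z.re := lt_trans (by linarith) hz
    refine DifferentiableAt.differentiableWithinAt ?_
    rcases eq_or_ne t 0 with rfl | ht
    · simp
    · exact (DifferentiableAt.const_cpow (by fun_prop)
        (Or.inl (by exact_mod_cast ht))).const_mul _
  · filter_upwards [ae_restrict_mem measurableSet_Ioi] with t ht z hz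
    have ht' : (1 : ℝ) < t := ht
    have hz' : s.re / 2 < z.re := hz
    refine (norm_fract_mul_cpow_le (one_pos.trans ht')).trans ?_
    exact Real.rpow_le_rpow_of_exponent_le ht'.le (by linarith)

lemma zetaReg_eq_of_one_lt_re {s : ℂ} (hs : 1 < s.re) :
    zetaReg s = s - s * (s - 1) * fractIntegral s := by
  have hs0 : 0 < s.re := one_pos.trans hs
  have hs1 : s ≠ 1 := by
    rintro rfl
    simp at hs
  have h0 := ne_zero_of_re_pos hs0
  have h1 : s - 1 ≠ 0 := sub_ne_zero.mpr hs1
  have hz : riemannZeta s =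
      s * ∫ t in Ioi (1 : ℝ), (⌊t⌋₊ : ℂ) * (t : ℂ) ^ (-(s + 1)) := by
    rw [← LSeries_one_eq_riemannZeta hs, LSeries_eq_mul_integral' 1 zero_le_one hs]
    · simp
    · simp only [Pi.one_apply, norm_one, Finset.sum_const, Nat.card_Icc, add_tsub_cancel_right,
        nsmul_eq_mul, mul_one, Real.rpow_one]
      exact Asymptotics.isBigO_refl _ _
  have hpow : ∀ t ∈ Ioi (1 : ℝ), (t : ℂ) * (t : ℂ) ^ (-(s + 1)) = (t : ℂ) ^ (-s) := by
    intro t ht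
    have : (t : ℂ) ≠ 0 := by exact_mod_cast (one_pos.trans ht).ne'
    rw [show -s = 1 + -(s + 1) by ring, cpow_add _ _ this, cpow_one]
  have hi : IntegrableOn (fun t : ℝ => (t : ℂ) ^ (-s)) (Ioi 1) :=
    integrableOn_Ioi_cpow_of_lt (by simpa using hs) one_pos
  have hI : ∫ t in Ioi (1 : ℝ), (t : ℂ) ^ (-s) = 1 / (s - 1) := by
    rw [integral_Ioi_cpow_of_lt (by simpa using hs) one_pos, ofReal_one, one_cpow, neg_div,
      ← div_neg]
    congr 1
    ring
  have hJ : ∫ t in Ioi (1 : ℝ), (⌊t⌋₊ : ℂ) * (t : ℂ) ^ (-(s + 1))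
      = 1 / (s - 1) - fractIntegral s := by
    rw [← hI, fractIntegral, ← integral_sub hi (integrableOn_fract_mul_cpow hs0)]
    refine setIntegral_congr_fun measurableSet_Ioi fun t ht => ?_
    have ht0 : 0 ≤ t := (one_pos.trans ht).le
    rw [← hpow t ht, Int.fract, ← natCast_floor_eq_intCast_floor ht0]
    push_cast
    ring
  rw [zetaReg_eq hs0 hs1, hz, hJ]
  field_simp

/-- Analytic continuation of `ζ(s) = s / (s - 1) - s ∫₁^∞ {t} t^(-s-1) dt` to `Re s > 0`. -/
lemma zetaReg_eq_fractIntegral {s : ℂ} (hs : 0 < s.re) :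
    zetaReg s = s - s * (s - 1) * fractIntegral s := by
  have hU := isOpen_re_gt 0
  have h1 : AnalyticOnNhd ℂ zetaReg {s | 0 < s.re} := differentiableOn_zetaReg.analyticOnNhd hU
  have h2 : AnalyticOnNhd ℂ (fun s => s - s * (s - 1) * fractIntegral s) {s | 0 < s.re} := by
    refine DifferentiableOn.analyticOnNhd ?_ hU
    exact differentiableOn_id.sub ((differentiableOn_id.mul
      (differentiableOn_id.sub_const 1)).mul differentiableOn_fractIntegral)
  refine h1.eqOn_of_preconnected_of_eventuallyEq h2 (z₀ := 2)
    (convex_halfSpace_re_gt 0).isPreconnected (by simp) ?_ hs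
  filter_upwards [(isOpen_re_gt 1).mem_nhds (show (2 : ℂ) ∈ {s : ℂ | 1 < s.re} by simp)] with z hz
  exact zetaReg_eq_of_one_lt_re hz

/-- The Mellin transform of `t ↦ {t / k}`. -/
lemma hasMellin_fract_div {s : ℂ} (hs0 : 0 < s.re) (hs1 : s.re < 1) {k : ℕ} (hk : 1 ≤ k) :
    HasMellin (eFun k) (-s) (-((k : ℂ) ^ (-s) * riemannZeta s / s)) := by
  have hne1 : s ≠ 1 := by
    rintro rfl
    simp at hs1
  have hs0' := ne_zero_of_re_pos hs0
  have h1' : s - 1 ≠ 0 := sub_ne_zero.mpr hne1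
  have hU : Ioi (0 : ℝ) = Ioc 0 1 ∪ Ioi 1 := (Ioc_union_Ioi_eq_Ioi zero_le_one).symm
  have heq : EqOn (fun t : ℝ => (t : ℂ) ^ (-s - 1) • ((Int.fract t : ℝ) : ℂ))
      (fun t : ℝ => (t : ℂ) ^ (-s)) (Ioo 0 1) := by
    intro t ht
    have h0 : (t : ℂ) ≠ 0 := by exact_mod_cast ht.1.ne'
    have h1 : Int.fract t = t := Int.fract_eq_self.mpr ⟨ht.1.le, ht.2⟩
    simp only
    rw [h1, smul_eq_mul, cpow_sub _ _ h0, cpow_one, div_mul_cancel₀ _ h0]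
  have hre : -1 < (-s).re := by
    rw [neg_re]
    linarith
  have hi1 : IntegrableOn (fun t : ℝ => (t : ℂ) ^ (-s)) (Ioc 0 1) :=
    (intervalIntegrable_iff_integrableOn_Ioc_of_le zero_le_one).mp
      (intervalIntegral.intervalIntegrable_cpow' hre)
  have hi1' : IntegrableOn (fun t : ℝ => (t : ℂ) ^ (-s - 1) • ((Int.fract t : ℝ) : ℂ))
      (Ioc 0 1) := by
    rw [integrableOn_Ioc_iff_integrableOn_Ioo] at hi1 ⊢
    exact hi1.congr_fun heq.symm measurableSet_Ioo
  have heq2 : (fun t : ℝ => (t : ℂ) ^ (-s - 1) • ((Int.fract t : ℝ) : ℂ))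
      = fun t : ℝ => ((Int.fract t : ℝ) : ℂ) * (t : ℂ) ^ (-(s + 1)) := by
    funext t
    rw [smul_eq_mul, mul_comm, neg_add']
  have hi2 : IntegrableOn (fun t : ℝ => (t : ℂ) ^ (-s - 1) • ((Int.fract t : ℝ) : ℂ)) (Ioi 1) := by
    rw [heq2]
    exact integrableOn_fract_mul_cpow hs0
  have hconv : MellinConvergent (fun t : ℝ => ((Int.fract t : ℝ) : ℂ)) (-s) := by
    rw [MellinConvergent, hU]
    exact hi1'.union hi2
  have hval : mellin (fun t : ℝ => ((Int.fract t : ℝ) : ℂ)) (-s) = -(riemannZeta s / s) := by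
    rw [mellin, hU, setIntegral_union Ioc_disjoint_Ioi_same measurableSet_Ioi hi1' hi2,
      integral_Ioc_eq_integral_Ioo, setIntegral_congr_fun measurableSet_Ioo heq,
      ← integral_Ioc_eq_integral_Ioo, ← intervalIntegral.integral_of_le zero_le_one,
      integral_cpow (Or.inl hre), heq2]
    change _ + fractIntegral s = _
    have h2 := zetaReg_eq_fractIntegral hs0
    rw [zetaReg_eq hs0 hne1] at h2
    have h3 : -s + 1 ≠ 0 := by
      rw [neg_add_eq_sub]
      exact sub_ne_zero.mpr hne1.symm
    rw [ofReal_one, ofReal_zero, one_cpow, zero_cpow h3, sub_zero]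
    have h4 : fractIntegral s = (s - (s - 1) * riemannZeta s) / (s * (s - 1)) := by
      rw [eq_div_iff (mul_ne_zero hs0' h1')]
      linear_combination h2
    rw [h4]
    field_simp
    ring
  have hk0 : (0 : ℝ) < (k : ℝ)⁻¹ := by positivity
  have hfun : eFun k = fun t : ℝ => ((Int.fract ((k : ℝ)⁻¹ * t) : ℝ) : ℂ) := by
    funext t
    rw [eFun, div_eq_inv_mul]
  rw [hfun]
  refine ⟨(MellinConvergent.comp_mul_left
    (f := fun t : ℝ => ((Int.fract t : ℝ) : ℂ)) hk0).mpr hconv, ?_⟩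
  rw [mellin_comp_mul_left (fun t : ℝ => ((Int.fract t : ℝ) : ℂ)) _ hk0, hval, neg_neg, smul_eq_mul,
    ofReal_inv, inv_cpow _ _ (by rw [ofReal_natCast, natCast_arg]; exact Real.pi_ne_zero.symm),
    ← cpow_neg, ofReal_natCast]
  ring

end BaezDuarte

/-! ### From `χ ∈ closure B` to the Riemann hypothesis -/

namespace BaezDuarte

open Filter Topology Complex ComplexConjugate

lemma integral_weight (g : ℝ → ℂ) :
    ∫ t, g t ∂weight = ∫ t in Ioi (0 : ℝ), ((1 / t ^ 2 : ℝ) : ℂ) * g t := by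
  have hd : Measurable (fun t : ℝ => ENNReal.ofReal (1 / t ^ 2)) := by fun_prop
  rw [weight, integral_withDensity_eq_integral_toReal_smul hd (by simp)]
  refine setIntegral_congr_fun measurableSet_Ioi fun t ht => ?_
  rw [ENNReal.toReal_ofReal (by positivity), Complex.real_smul]

/-- The function `t ↦ conj (t ^ (1 - s))` on `[1, ∞)`, extended by `0`. -/
noncomputable def tailFun (s : ℂ) : ℝ → ℂ :=
  (Ici (1 : ℝ)).indicator (fun t => conj ((t : ℂ) ^ (1 - s)))

lemma measurable_tailFun (s : ℂ) : Measurable (tailFun s) := by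
  refine Measurable.indicator ?_ measurableSet_Ici
  have : Measurable fun t : ℝ => (t : ℂ) ^ (1 - s) := by fun_prop
  exact continuous_conj.measurable.comp this

lemma memLp_tailFun {s : ℂ} (hs : 1 / 2 < s.re) : MemLp (tailFun s) 2 weight := by
  have hmeas := measurable_tailFun s
  rw [memLp_two_iff_integrable_sq_norm hmeas.aestronglyMeasurable, weight,
    integrable_withDensity_iff_integrable_smul' (by fun_prop) (by simp)]
  have hf : ∀ t ∈ Ioi (0 : ℝ), (ENNReal.ofReal (1 / t ^ 2)).toReal • ‖tailFun s t‖ ^ 2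
      = (Ici (1 : ℝ)).indicator (fun t => t ^ (-(2 * s.re))) t := by
    intro t ht
    have ht0 : (0 : ℝ) < t := ht
    rw [ENNReal.toReal_ofReal (by positivity), smul_eq_mul]
    by_cases h : t ∈ Ici (1 : ℝ)
    · rw [tailFun, indicator_of_mem h, indicator_of_mem h, RCLike.norm_conj,
        norm_cpow_eq_rpow_re_of_pos ht0, ← Real.rpow_natCast (t ^ _), ← Real.rpow_mul ht0.le,
        ← Real.rpow_natCast t, one_div, ← Real.rpow_neg ht0.le, ← Real.rpow_add ht0]
      congr 1
      simp only [sub_re, one_re]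
      push_cast
      ring
    · rw [tailFun, indicator_of_notMem h, indicator_of_notMem h]
      simp
  refine (integrableOn_congr_fun hf measurableSet_Ioi).mpr ?_
  refine Integrable.integrableOn ?_
  rw [integrable_indicator_iff measurableSet_Ici, integrableOn_Ici_iff_integrableOn_Ioi]
  exact integrableOn_Ioi_rpow_of_lt (by linarith) one_pos

lemma integral_tailFun_mul {s : ℂ} {f : ℝ → ℂ} (hf : ∀ t ∈ Ioo (0 : ℝ) 1, f t = 0) :
    ∫ t, f t * conj (tailFun s t) ∂weight = mellin f (-s) := by
  rw [integral_weight, mellin]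
  refine setIntegral_congr_fun measurableSet_Ioi fun t ht => ?_
  have ht0 : (0 : ℝ) < t := ht
  have ht0' : (t : ℂ) ≠ 0 := by exact_mod_cast ht0.ne'
  simp only [smul_eq_mul]
  by_cases h : t ∈ Ici (1 : ℝ)
  · rw [tailFun, indicator_of_mem h, conj_conj,
      show 1 - s = (-s - 1) + (2 : ℕ) by push_cast; ring, cpow_add _ _ ht0', cpow_natCast]
    push_cast
    field_simp
  · rw [hf t ⟨ht0, not_le.mp h⟩]
    simp

/-- The Mellin transform of `χ`. -/
lemma hasMellin_chiFun {s : ℂ} (hs : 0 < s.re) : HasMellin chiFun (-s) (1 / s) := by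
  have h1 : ∀ t ∈ Ioi (0 : ℝ), (t : ℂ) ^ (-s - 1) • chiFun t
      = (Ici (1 : ℝ)).indicator (fun t : ℝ => (t : ℂ) ^ (-s - 1)) t := by
    intro t _
    by_cases h : t ∈ Ici (1 : ℝ)
    · rw [chiFun, indicator_of_mem h, indicator_of_mem h, smul_eq_mul, mul_one]
    · rw [chiFun, indicator_of_notMem h, indicator_of_notMem h, smul_zero]
  have hre : (-s - 1).re < -1 := by
    rw [sub_re, neg_re, one_re]
    linarith
  constructor
  · rw [MellinConvergent, integrableOn_congr_fun h1 measurableSet_Ioi]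
    refine Integrable.integrableOn ?_
    rw [integrable_indicator_iff measurableSet_Ici, integrableOn_Ici_iff_integrableOn_Ioi]
    exact integrableOn_Ioi_cpow_of_lt hre one_pos
  · rw [mellin, setIntegral_congr_fun measurableSet_Ioi h1, setIntegral_indicator measurableSet_Ici,
      inter_eq_self_of_subset_right (Ici_subset_Ioi.mpr one_pos), integral_Ici_eq_integral_Ioi,
      integral_Ioi_cpow_of_lt hre one_pos, ofReal_one, one_cpow, sub_add_cancel, neg_div_neg_eq]

/-- A zero of `ζ` with real part in `(1/2, 1)` provides a continuous functional which vanishes on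
`B₀` and not at `χ`. -/
lemma riemannZeta_ne_zero_of_chi_mem (h : chi ∈ B₀.topologicalClosure) {s : ℂ}
    (hs : 1 / 2 < s.re) (hs1 : s.re < 1) : riemannZeta s ≠ 0 := by
  intro hz
  have hs0 : 0 < s.re := by linarith
  set ψ : H := (memLp_tailFun hs).toLp (tailFun s) with hψ
  have key : ∀ (f : H) (g : ℝ → ℂ), f =ᵐ[weight] g → (∀ t ∈ Ioo (0 : ℝ) 1, g t = 0) →
      inner ℂ ψ f = mellin g (-s) := by
    intro f g hfg hg
    rw [L2.inner_def, ← integral_tailFun_mul hg]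
    refine integral_congr_ae ?_
    filter_upwards [hfg, (memLp_tailFun hs).coeFn_toLp] with t h1 h2
    rw [RCLike.inner_apply, h1, hψ, h2]
  have hB : ∀ f ∈ B₀, inner ℂ ψ f = 0 := by
    intro f hf
    induction hf using Submodule.span_induction with
    | mem x hx =>
      obtain ⟨k, hk, rfl⟩ := hx
      have hk1 : 1 ≤ k := le_trans one_le_two hk
      simp only
      rw [key _ (fun t => eFun k t - (1 / (k : ℂ)) • eFun 1 t)]
      · have h1 := hasMellin_fract_div hs0 hs1 hk1
        have h2 := hasMellin_fract_div hs0 hs1 le_rfl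
        have h3 := (hasMellin_sub h1.1 (h2.1.const_smul (1 / (k : ℂ)))).2
        rw [h3, mellin_const_smul, h1.2, h2.2, hz]
        simp
      · filter_upwards [Lp.coeFn_sub (e k) ((1 / (k : ℂ)) • e 1),
          Lp.coeFn_smul (1 / (k : ℂ)) (e 1), (memLp_eFun k).coeFn_toLp,
          (memLp_eFun 1).coeFn_toLp] with t h1 h2 h3 h4
        rw [h1, Pi.sub_apply, h2, Pi.smul_apply, e, h3, e, h4]
      · intro t ht
        have hk0 : (0 : ℝ) < k := by exact_mod_cast hk1
        have hk1' : (1 : ℝ) ≤ k := by exact_mod_cast hk1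
        have h1 : Int.fract (t / k) = t / k := Int.fract_eq_self.mpr
          ⟨(div_pos ht.1 hk0).le, (div_lt_one hk0).mpr (ht.2.trans_le hk1')⟩
        have h2 : Int.fract (t / (1 : ℕ)) = t :=
          by simpa using Int.fract_eq_self.mpr ⟨ht.1.le, ht.2⟩
        rw [eFun, eFun, h1, h2]
        push_cast
        rw [smul_eq_mul]
        ring
    | zero => simp
    | add x y _ _ hx hy => rw [inner_add_right, hx, hy, add_zero]
    | smul c x _ hx => rw [inner_smul_right, hx, mul_zero]
  have hchi0 : inner ℂ ψ chi = 0 := by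
    rw [← SetLike.mem_coe, Submodule.topologicalClosure_coe] at h
    exact closure_minimal (s := (B₀ : Set H)) (t := {f | inner ℂ ψ f = 0}) hB
      (isClosed_eq (by fun_prop) continuous_const) h
  have hchi1 : inner ℂ ψ chi = 1 / s := by
    rw [key chi chiFun memLp_chiFun.coeFn_toLp fun t ht => by
      rw [chiFun, indicator_of_notMem (by simpa using ht.2)]]
    exact (hasMellin_chiFun hs0).2
  rw [hchi1] at hchi0
  exact one_div_ne_zero (ne_zero_of_re_pos hs0) hchi0

/-- By the functional equation, the Riemann hypothesis says that `ζ` has no zeros with real part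
greater than `1/2`. -/
lemma riemannHypothesis_iff :
    RiemannHypothesis ↔ ∀ s : ℂ, 1 / 2 < s.re → riemannZeta s ≠ 0 := by
  constructor
  · intro h s hs hz
    refine hs.ne' (h s hz ?_ ?_)
    · rintro ⟨n, rfl⟩
      have : (0 : ℝ) ≤ n := Nat.cast_nonneg n
      simp at hs
      linarith
    · rintro rfl
      exact riemannZeta_one_ne_zero hz
  · intro h s hz htriv hs1
    by_contra hne
    rcases lt_or_gt_of_ne hne with hlt | hgt
    · have hs0 : s ≠ 0 := by
        rintro rfl
        rw [riemannZeta_zero] at hz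
        norm_num at hz
      rw [riemannZeta_def_of_ne_zero hs0, div_eq_zero_iff] at hz
      rcases hz with hz | hz
      · have h1s : 1 - s ≠ 0 := sub_ne_zero.mpr hs1.symm
        refine h (1 - s) ?_ ?_
        · simp only [sub_re, one_re]
          linarith
        · rw [riemannZeta_def_of_ne_zero h1s, completedRiemannZeta_one_sub, hz, zero_div]
      · obtain ⟨n, hn⟩ := Gammaℝ_eq_zero_iff.mp hz
        rcases n with _ | m
        · simp [hs0] at hn
        · exact htriv ⟨m, by rw [hn]; push_cast; ring⟩
    · exact h s hgt hz

theorem riemannHypothesis_of_chi_mem (h : chi ∈ B.topologicalClosure) : RiemannHypothesis := by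
  rw [riemannHypothesis_iff]
  intro s hs
  rcases lt_or_ge s.re 1 with h1 | h1
  · exact riemannZeta_ne_zero_of_chi_mem (chi_mem_closure_B₀_iff.mpr h) hs h1
  · exact riemannZeta_ne_zero_of_one_le_re h1

end BaezDuarte

/-! ### Lower bounds for the zeta function under the Riemann hypothesis -/

namespace BaezDuarte

open Filter Topology Complex ComplexConjugate

/-- A zero-free holomorphic function on a disc which is bounded by `e^K` times its absolute value
at the centre cannot become small: apply the Borel–Carathéodory theorem to its logarithm. -/
lemma norm_ge_of_ne_zero_of_norm_le {f : ℂ → ℂ} {c z : ℂ} {R K : ℝ} (hK : 0 < K)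
    (hf : DifferentiableOn ℂ f (Metric.ball c R)) (hne : ∀ w ∈ Metric.ball c R, f w ≠ 0)
    (hle : ∀ w ∈ Metric.ball c R, ‖f w‖ ≤ Real.exp K * ‖f c‖) (hz : z ∈ Metric.ball c R) :
    ‖f c‖ * Real.exp (-(2 * K * ‖z - c‖ / (R - ‖z - c‖))) ≤ ‖f z‖ := by
  have hR : 0 < R := Metric.pos_of_mem_ball hz
  have hc : c ∈ Metric.ball c R := Metric.mem_ball_self hR
  have hlog : DifferentiableOn ℂ (fun w => deriv f w / f w) (Metric.ball c R) :=
    (hf.deriv Metric.isOpen_ball).div hf hne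
  obtain ⟨g, hgc, hg⟩ := hlog.isExactOn_ball.with_val_at c 0
  have hfd : ∀ w ∈ Metric.ball c R, HasDerivAt f (deriv f w) w := fun w hw =>
    (hf.differentiableAt (Metric.isOpen_ball.mem_nhds hw)).hasDerivAt
  have hder : ∀ w ∈ Metric.ball c R, HasDerivAt (fun w => f w * exp (-g w)) 0 w := by
    intro w hw
    have h : HasDerivAt (fun w => f w * exp (-g w)) (deriv f w * exp (-g w)
        + f w * (exp (-g w) * -(deriv f w / f w))) w := (hfd w hw).mul (hg w hw).neg.cexp
    have h0 := hne w hw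
    have h1 : deriv f w * exp (-g w) + f w * (exp (-g w) * -(deriv f w / f w)) = 0 := by
      field_simp
      ring
    rwa [h1] at h
  have hconst : ∀ w ∈ Metric.ball c R, f w = f c * exp (g w) := by
    intro w hw
    have h := Metric.isOpen_ball.is_const_of_deriv_eq_zero (Metric.isPreconnected_ball)
      (fun w hw => (hder w hw).differentiableAt.differentiableWithinAt)
      (fun w hw => (hder w hw).deriv) hw hc
    simp only [hgc, neg_zero, exp_zero, mul_one] at h
    rw [← h, mul_assoc, ← exp_add, neg_add_cancel, exp_zero, mul_one]
  have hfc : 0 < ‖f c‖ := norm_pos_iff.mpr (hne c hc)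
  have hre : ∀ w ∈ Metric.ball c R, (g w).re ≤ K := by
    intro w hw
    have h := hle w hw
    rw [hconst w hw, norm_mul, norm_exp, mul_comm] at h
    exact Real.exp_le_exp.mp (le_of_mul_le_mul_right h hfc)
  have hmaps : MapsTo (fun w => c + w) (Metric.ball 0 R) (Metric.ball c R) := fun w hw => by
    simpa [Metric.mem_ball, dist_eq_norm] using hw
  have hz' : z - c ∈ Metric.ball (0 : ℂ) R := by
    simpa [Metric.mem_ball, dist_eq_norm] using hz
  have hB := borelCaratheodory_zero (f := fun w => g (c + w)) hK
    (DifferentiableOn.comp (t := Metric.ball c R)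
      (fun w hw => (hg w hw).differentiableAt.differentiableWithinAt)
      (by fun_prop) hmaps)
    (fun w hw => hre _ (hmaps hw)) hR hz' (by simpa using hgc)
  simp only [add_sub_cancel] at hB
  rw [hconst z hz, norm_mul, norm_exp]
  refine mul_le_mul_of_nonneg_left (Real.exp_le_exp.mpr ?_) hfc.le
  have h1 := abs_re_le_norm (g z)
  have h2 := neg_abs_le (g z).re
  linarith

/-- The Dirichlet series of `1 / ζ`. -/
lemma hasSum_moebius {s : ℂ} (hs : 1 < s.re) :
    HasSum (fun n : ℕ => (ArithmeticFunction.moebius n : ℂ) * (n : ℂ) ^ (-s))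
      (riemannZeta s)⁻¹ := by
  have h1 : LSeriesSummable (fun n => (ArithmeticFunction.moebius n : ℂ)) s :=
    ArithmeticFunction.LSeriesSummable_moebius_iff.mpr hs
  have h2 := LSeries_one_mul_Lseries_moebius hs
  rw [LSeries_one_eq_riemannZeta hs] at h2
  have h3 := h1.LSeriesHasSum
  rw [eq_inv_of_mul_eq_one_right h2, LSeriesHasSum] at h3
  convert h3 using 2 with n
  rw [LSeries.term_def]
  split_ifs with h
  · simp [h]
  · rw [cpow_neg, div_eq_mul_inv]

/-- The zeta value `ζ(2)`, which bounds `|ζ|` and `1 / |ζ|` on `Re s ≥ 2`. -/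
noncomputable def zetaTwo : ℝ := ∑' n : ℕ, (n : ℝ) ^ (-2 : ℝ)

lemma hasSum_zetaTwo : HasSum (fun n : ℕ => (n : ℝ) ^ (-2 : ℝ)) zetaTwo :=
  (Real.summable_nat_rpow.mpr (by norm_num)).hasSum

lemma one_le_zetaTwo : 1 ≤ zetaTwo := by
  have := hasSum_zetaTwo.summable.le_tsum 1 (fun n _ => by positivity)
  simpa [zetaTwo] using this

lemma norm_natCast_cpow_neg_le (n : ℕ) {s : ℂ} (hs : 2 ≤ s.re) :
    ‖(n : ℂ) ^ (-s)‖ ≤ (n : ℝ) ^ (-2 : ℝ) := by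
  rcases Nat.eq_zero_or_pos n with rfl | hn
  · have : -s ≠ 0 := neg_ne_zero.mpr (ne_zero_of_re_pos (by linarith))
    simp [this]
  · rw [norm_natCast_cpow_of_pos hn, neg_re]
    exact Real.rpow_le_rpow_of_exponent_le (by exact_mod_cast hn) (by linarith)

lemma norm_inv_riemannZeta_le {s : ℂ} (hs : 2 ≤ s.re) : ‖(riemannZeta s)⁻¹‖ ≤ zetaTwo := by
  rw [← (hasSum_moebius (one_lt_two.trans_le hs)).tsum_eq]
  refine tsum_of_norm_bounded hasSum_zetaTwo fun n => ?_
  rw [norm_mul]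
  refine (mul_le_of_le_one_left (norm_nonneg _) ?_).trans (norm_natCast_cpow_neg_le n hs)
  rw [norm_intCast]
  exact_mod_cast ArithmeticFunction.abs_moebius_le_one

lemma norm_riemannZeta_le {s : ℂ} (hs : 2 ≤ s.re) : ‖riemannZeta s‖ ≤ zetaTwo := by
  rw [zeta_eq_tsum_one_div_nat_cpow (one_lt_two.trans_le hs)]
  refine tsum_of_norm_bounded hasSum_zetaTwo fun n => ?_
  rw [one_div, ← cpow_neg]
  exact norm_natCast_cpow_neg_le n hs

lemma norm_le_of_abs_re_le {s : ℂ} {a : ℝ} (h : |s.re| ≤ a) : ‖s‖ ≤ a + |s.im| :=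
  (norm_le_abs_re_add_abs_im s).trans (by linarith)

lemma norm_zetaReg_le {s : ℂ} (hs : 1 / 8 ≤ s.re) (hs4 : s.re ≤ 4) :
    ‖zetaReg s‖ ≤ 40 * (2 + |s.im|) ^ 2 := by
  have hs0 : 0 < s.re := by linarith
  have h0 := abs_nonneg s.im
  rw [zetaReg_eq_fractIntegral hs0]
  have h1 : ‖s‖ ≤ 4 + |s.im| := norm_le_of_abs_re_le (abs_le.mpr ⟨by linarith, hs4⟩)
  have h2 : ‖s - 1‖ ≤ 3 + |s.im| := by
    have := norm_le_of_abs_re_le (s := s - 1) (a := 3)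
      (abs_le.mpr ⟨by simp only [sub_re, one_re]; linarith,
        by simp only [sub_re, one_re]; linarith⟩)
    simpa using this
  have h3 : ‖fractIntegral s‖ ≤ 8 := by
    refine (norm_fractIntegral_le hs0).trans ?_
    rw [div_le_iff₀ hs0]
    linarith
  calc ‖s - s * (s - 1) * fractIntegral s‖
      ≤ ‖s‖ + ‖s‖ * ‖s - 1‖ * ‖fractIntegral s‖ := by
        refine (norm_sub_le _ _).trans ?_
        rw [norm_mul, norm_mul]
    _ ≤ (4 + |s.im|) + (4 + |s.im|) * (3 + |s.im|) * 8 := by gcongr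
    _ ≤ _ := by nlinarith

lemma zetaReg_ne_zero (hRH : ∀ s : ℂ, 1 / 2 < s.re → riemannZeta s ≠ 0)
    {s : ℂ} (hs : 1 / 2 < s.re) : zetaReg s ≠ 0 := by
  rcases eq_or_ne s 1 with rfl | h1
  · rw [zetaReg_one]
    exact one_ne_zero
  · rw [zetaReg_eq (by linarith) h1]
    exact mul_ne_zero (sub_ne_zero.mpr h1) (hRH s hs)

lemma xi_ne_zero (hRH : ∀ s : ℂ, 1 / 2 < s.re → riemannZeta s ≠ 0)
    {s : ℂ} (hs : 1 / 2 < s.re) : xi s ≠ 0 := by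
  have h0 : 0 < s.re := by linarith
  rw [xi_eq_zetaReg h0]
  exact mul_ne_zero (mul_ne_zero (ne_zero_of_re_pos h0) (Gammaℝ_ne_zero h0))
    (zetaReg_ne_zero hRH hs)

/-- The consequence of `norm_ge_of_ne_zero_of_norm_le` for `(s - 1) ζ(s)`: a lower bound by a power
of `|Im c|` at the centre of a disc propagates to the disc. -/
lemma zetaReg_ge_of_center (hRH : ∀ s : ℂ, 1 / 2 < s.re → riemannZeta s ≠ 0)
    {A R : ℝ} :
    ∃ a : ℝ, 0 < a ∧ ∀ (c z : ℂ), 1 / 2 + R ≤ c.re → c.re + R ≤ 4 → R ≤ 2 →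
      (2 + |c.im|) ^ (-A) ≤ ‖zetaReg c‖ → ‖z - c‖ < R →
      ‖zetaReg c‖ * (2 + |c.im|) ^ (-(a * ‖z - c‖ / (R - ‖z - c‖))) ≤ ‖zetaReg z‖ := by
  -- on the disc `2 + |Im w| ≤ 2 T` with `T = 2 + |Im c|`, so `40 * (2 T)² = 160 T² ≤ T^(b + 2)`
  obtain ⟨b, hb⟩ := pow_unbounded_of_one_lt (160 : ℝ) one_lt_two
  set a : ℝ := b + 2 + |A| with ha
  refine ⟨2 * a, by positivity, fun c z hc1 hc2 hR2 hcA hz => ?_⟩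
  set T := 2 + |c.im| with hT
  have hT2 : 2 ≤ T := by
    have := abs_nonneg c.im
    linarith
  have hT0 : 0 < T := by linarith
  have hlog : 0 < Real.log T := Real.log_pos (by linarith)
  have hR : 0 < R := (norm_nonneg _).trans_lt hz
  have hsub : ∀ w ∈ Metric.ball c R, 1 / 2 < w.re ∧ w.re ≤ 4 ∧ 2 + |w.im| ≤ 2 * T := by
    intro w hw
    have h1 : ‖w - c‖ < R := by rwa [Metric.mem_ball, dist_eq_norm] at hw
    have h2 := (abs_re_le_norm (w - c)).trans_lt h1
    have h3 := (abs_im_le_norm (w - c)).trans_lt h1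
    rw [sub_re, abs_lt] at h2
    rw [sub_im] at h3
    have h4 := abs_sub_abs_le_abs_sub w.im c.im
    exact ⟨by linarith, by linarith, by linarith⟩
  have h := norm_ge_of_ne_zero_of_norm_le (f := zetaReg) (c := c) (z := z) (R := R)
    (K := a * Real.log T) (by positivity)
    (differentiableOn_zetaReg.mono fun w hw => by
      have := (hsub w hw).1
      simp only [mem_ofPred_eq]
      linarith)
    (fun w hw => zetaReg_ne_zero hRH (hsub w hw).1) ?_ ?_
  · refine le_trans (le_of_eq ?_) h
    congr 1
    rw [Real.rpow_def_of_pos hT0]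
    congr 1
    ring
  · intro w hw
    obtain ⟨h1, h2, h3⟩ := hsub w hw
    have hexp : Real.exp (a * Real.log T) = T ^ a := by
      rw [Real.rpow_def_of_pos hT0, mul_comm]
    rw [hexp]
    have h0 := abs_nonneg w.im
    calc ‖zetaReg w‖ ≤ 40 * (2 + |w.im|) ^ 2 := norm_zetaReg_le (by linarith) h2
      _ ≤ 40 * (2 * T) ^ 2 := by gcongr
      _ = 160 * T ^ 2 := by ring
      _ ≤ 2 ^ b * T ^ 2 := by gcongr
      _ ≤ T ^ b * T ^ 2 := by gcongr
      _ = T ^ ((b : ℝ) + 2) := by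
        rw [Real.rpow_add hT0, Real.rpow_natCast, Real.rpow_two]
      _ ≤ T ^ (a + -A) := Real.rpow_le_rpow_of_exponent_le (by linarith) (by
        have := le_abs_self A
        rw [ha]
        linarith)
      _ = T ^ a * T ^ (-A) := Real.rpow_add hT0 _ _
      _ ≤ T ^ a * ‖zetaReg c‖ := by gcongr
  · rwa [Metric.mem_ball, dist_eq_norm]

/-- Under the Riemann hypothesis, `1 / ζ` has at most polynomial growth in every half-plane
`Re s ≥ 1/2 + δ`. -/
lemma exists_rpow_le_norm_zetaReg (hRH : ∀ s : ℂ, 1 / 2 < s.re → riemannZeta s ≠ 0)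
    {δ : ℝ} (hδ : 0 < δ) :
    ∃ A : ℝ, 0 < A ∧ ∀ s : ℂ, 1 / 2 + δ ≤ s.re → (2 + |s.im|) ^ (-A) ≤ ‖zetaReg s‖ := by
  obtain ⟨b, hb⟩ := pow_unbounded_of_one_lt zetaTwo one_lt_two
  have hfar : ∀ s : ℂ, 2 ≤ s.re → (2 + |s.im|) ^ (-(b : ℝ)) ≤ ‖zetaReg s‖ := by
    intro s hs
    have hT : 2 ≤ 2 + |s.im| := by
      have := abs_nonneg s.im
      linarith
    have hs1 : s ≠ 1 := by
      rintro rfl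
      norm_num at hs
    have h1 := norm_inv_riemannZeta_le hs
    rw [norm_inv] at h1
    have hz : 0 < ‖riemannZeta s‖ := norm_pos_iff.mpr (hRH s (by linarith))
    have h2 : 1 ≤ ‖s - 1‖ := by
      refine le_trans ?_ (abs_re_le_norm (s - 1))
      rw [sub_re, one_re]
      exact le_trans (by linarith) (le_abs_self _)
    rw [zetaReg_eq (by linarith) hs1, norm_mul, Real.rpow_neg (by linarith), Real.rpow_natCast]
    calc ((2 + |s.im|) ^ b)⁻¹ ≤ (2 ^ b)⁻¹ := by gcongr
      _ ≤ zetaTwo⁻¹ := by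
        have := one_le_zetaTwo
        gcongr
      _ ≤ ‖riemannZeta s‖ := inv_le_of_inv_le₀ hz h1
      _ ≤ ‖s - 1‖ * ‖riemannZeta s‖ := le_mul_of_one_le_left hz.le h2
  obtain ⟨a, ha, hmain⟩ := zetaReg_ge_of_center hRH (A := b) (R := 3 / 2)
  refine ⟨b + a * (3 / 2) / δ, by positivity, fun s hs => ?_⟩
  have hT : 2 ≤ 2 + |s.im| := by
    have := abs_nonneg s.im
    linarith
  rcases le_or_gt 2 s.re with h2 | h2
  · refine le_trans (Real.rpow_le_rpow_of_exponent_le (by linarith) ?_) (hfar s h2)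
    have : 0 ≤ a * (3 / 2) / δ := by positivity
    linarith
  -- the disc about `2 + i Im s` of radius `3/2` touches the critical line
  · set c : ℂ := ⟨2, s.im⟩ with hc
    have hsc : ‖s - c‖ = 2 - s.re := by
      have : s - c = ((s.re - 2 : ℝ) : ℂ) := by
        apply Complex.ext <;> simp [hc]
      rw [this, norm_real, Real.norm_eq_abs, abs_of_neg (by linarith)]
      ring
    have hcfar := hfar c (le_refl 2)
    have h := hmain c s (by norm_num [hc]) (by norm_num [hc]) (by norm_num) hcfar
      (by rw [hsc]; linarith)
    rw [hsc] at h
    refine le_trans ?_ h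
    refine le_trans ?_ (mul_le_mul_of_nonneg_right hcfar (by positivity))
    change _ ≤ (2 + |s.im|) ^ (-(b : ℝ)) * (2 + |s.im|) ^ _
    rw [← Real.rpow_add (by linarith)]
    refine Real.rpow_le_rpow_of_exponent_le (by linarith) ?_
    have : a * (2 - s.re) / (3 / 2 - (2 - s.re)) ≤ a * (3 / 2) / δ := by
      gcongr <;> linarith
    linarith

/-- Under the Riemann hypothesis, a small displacement `w - u` changes `|ζ(s + w)|` at most by a
factor which is a small power of `|Im s|`. -/
lemma exists_zetaReg_comparison (hRH : ∀ s : ℂ, 1 / 2 < s.re → riemannZeta s ≠ 0)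
    {u ε : ℝ} (hu : 0 < u) (hu1 : u ≤ 1) (hε : 0 < ε) :
    ∃ η : ℝ, 0 < η ∧ ∀ s w : ℂ, s.re = 1 / 2 → ‖w - u‖ < η →
      ‖zetaReg (s + u)‖ * (2 + |s.im|) ^ (-ε) ≤ ‖zetaReg (s + w)‖ := by
  obtain ⟨A, hA, hlow⟩ := exists_rpow_le_norm_zetaReg hRH hu
  obtain ⟨a, ha, hmain⟩ := zetaReg_ge_of_center hRH (A := A) (R := u / 2)
  refine ⟨min (u / 4) (ε * u / (4 * a)), by positivity, fun s w hs hw => ?_⟩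
  have him : (s + u).im = s.im := by simp
  have hre : (s + u).re = 1 / 2 + u := by simp [hs]
  have hT : 2 ≤ 2 + |s.im| := by
    have := abs_nonneg s.im
    linarith
  have hd : s + w - (s + u) = w - u := by ring
  have h1 := hw.trans_le (min_le_left _ _)
  have h2 := hw.trans_le (min_le_right _ _)
  have h := hmain (s + u) (s + w) (by rw [hre]; linarith) (by rw [hre]; linarith) (by linarith)
    (hlow _ (by rw [hre])) (by rw [hd]; linarith)
  rw [hd, him] at h
  refine le_trans (mul_le_mul_of_nonneg_left ?_ (norm_nonneg _)) h
  refine Real.rpow_le_rpow_of_exponent_le (by linarith) ?_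
  rw [neg_le_neg_iff, div_le_iff₀ (by linarith)]
  rw [lt_div_iff₀ (by positivity)] at h2
  nlinarith

end BaezDuarte

/-! ### Ratios of Gamma values -/

namespace BaezDuarte

open Filter Topology Complex ComplexConjugate

/-- The factor `1 + t² / y²` of the product `|Γ(x) / Γ(x + it)|² = ∏ (1 + t² / (x + j)²)`. -/
noncomputable def gammaFactor (t y : ℝ) : ℝ := 1 + t ^ 2 / y ^ 2

lemma one_le_gammaFactor (t y : ℝ) : 1 ≤ gammaFactor t y := by
  have : 0 ≤ t ^ 2 / y ^ 2 := by positivity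
  rw [gammaFactor]
  linarith

lemma gammaFactor_pos (t y : ℝ) : 0 < gammaFactor t y := one_pos.trans_le (one_le_gammaFactor t y)

lemma gammaFactor_anti {t y z : ℝ} (hy : 0 < y) (hyz : y ≤ z) :
    gammaFactor t z ≤ gammaFactor t y := by
  rw [gammaFactor, gammaFactor]
  gcongr

/-- The weighted Hölder inequality for two pairs `(1, X)` and `(1, Y)`. -/
lemma one_add_geom_mean_le {α β X Y : ℝ} (hα : 0 ≤ α) (hβ : 0 ≤ β) (hαβ : α + β = 1)
    (hX : 0 ≤ X) (hY : 0 ≤ Y) : 1 + X ^ α * Y ^ β ≤ (1 + X) ^ α * (1 + Y) ^ β := by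
  have hX1 : 0 < 1 + X := by linarith
  have hY1 : 0 < 1 + Y := by linarith
  have h1 := Real.geom_mean_le_arith_mean2_weighted hα hβ (p₁ := 1 / (1 + X)) (p₂ := 1 / (1 + Y))
    (by positivity) (by positivity) hαβ
  have h2 := Real.geom_mean_le_arith_mean2_weighted hα hβ (p₁ := X / (1 + X)) (p₂ := Y / (1 + Y))
    (by positivity) (by positivity) hαβ
  rw [Real.div_rpow zero_le_one hX1.le, Real.div_rpow zero_le_one hY1.le, Real.one_rpow,
    Real.one_rpow] at h1
  rw [Real.div_rpow hX hX1.le, Real.div_rpow hY hY1.le] at h2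
  have h3 : 0 < (1 + X) ^ α * (1 + Y) ^ β := by positivity
  have h4 : α * (1 / (1 + X)) + β * (1 / (1 + Y)) +
      (α * (X / (1 + X)) + β * (Y / (1 + Y))) = 1 := by
    field_simp
    linear_combination (1 + X) * (1 + Y) * hαβ
  have h5 : (1 + X ^ α * Y ^ β) / ((1 + X) ^ α * (1 + Y) ^ β) ≤ 1 := by
    rw [add_div, ← div_mul_div_comm, ← one_mul (1 : ℝ), ← div_mul_div_comm]
    linarith
  exact (div_le_one h3).mp h5

/-- Logarithmic convexity of `y ↦ 1 + t² / y²`, for `y` between `y - 1` and `y + a`. -/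
lemma gammaFactor_mul_rpow_le {t y a : ℝ} (hy : 1 < y) (ha : 0 ≤ a) :
    gammaFactor t y * gammaFactor t y ^ a ≤ gammaFactor t (y - 1) ^ a * gammaFactor t (y + a) := by
  have hy1 : 0 < y - 1 := by linarith
  have hya : 0 < y + a := by linarith
  have h1a : 0 < 1 + a := by linarith
  set α := a / (1 + a) with hα
  set β := 1 / (1 + a) with hβ
  have hα0 : 0 ≤ α := by positivity
  have hβ0 : 0 ≤ β := by positivity
  have hαβ : α + β = 1 := by
    rw [hα, hβ]
    field_simp
    ring
  have hG : (y - 1) ^ α * (y + a) ^ β ≤ y := by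
    refine (Real.geom_mean_le_arith_mean2_weighted hα0 hβ0 hy1.le hya.le hαβ).trans_eq ?_
    rw [hα, hβ]
    field_simp
    ring
  have hsq : ∀ v : ℝ, 0 < v → ∀ γ : ℝ, (t ^ 2 / v ^ 2) ^ γ = (t ^ 2) ^ γ / (v ^ γ) ^ 2 := by
    intro v hv γ
    rw [Real.div_rpow (by positivity) (by positivity), ← Real.rpow_natCast (v ^ γ),
      ← Real.rpow_natCast v, ← Real.rpow_mul hv.le, ← Real.rpow_mul hv.le, mul_comm γ]
  have hT : (t ^ 2) ^ α * (t ^ 2) ^ β = t ^ 2 := by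
    rcases eq_or_ne t 0 with rfl | ht
    · have : β ≠ 0 := by positivity
      simp [this]
    · rw [← Real.rpow_add (by positivity), hαβ, Real.rpow_one]
  have hH : gammaFactor t y ≤ gammaFactor t (y - 1) ^ α * gammaFactor t (y + a) ^ β := by
    refine le_trans ?_ (one_add_geom_mean_le hα0 hβ0 hαβ (X := t ^ 2 / (y - 1) ^ 2)
      (Y := t ^ 2 / (y + a) ^ 2) (by positivity) (by positivity))
    rw [gammaFactor, hsq _ hy1, hsq _ hya, div_mul_div_comm, hT, ← mul_pow]
    gcongr
  have hβ1 : β * (1 + a) = 1 := by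
    rw [hβ]
    field_simp
  have hα1 : α * (1 + a) = a := by
    rw [hα]
    field_simp
  calc gammaFactor t y * gammaFactor t y ^ a = gammaFactor t y ^ (1 + a) := by
        rw [Real.rpow_add (gammaFactor_pos _ _), Real.rpow_one]
    _ ≤ (gammaFactor t (y - 1) ^ α * gammaFactor t (y + a) ^ β) ^ (1 + a) :=
        Real.rpow_le_rpow (gammaFactor_pos _ _).le hH h1a.le
    _ = _ := by
        rw [Real.mul_rpow (Real.rpow_nonneg (gammaFactor_pos _ _).le _)
          (Real.rpow_nonneg (gammaFactor_pos _ _).le _),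
          ← Real.rpow_mul (gammaFactor_pos _ _).le, ← Real.rpow_mul (gammaFactor_pos _ _).le,
          hα1, hβ1, Real.rpow_one]

lemma prod_gammaFactor_le {t x a : ℝ} (hx : 1 < x) (ha : 0 ≤ a) (n : ℕ) :
    ∏ j ∈ Finset.range n, gammaFactor t (x + j) ≤
      gammaFactor t (x - 1) ^ a * ∏ j ∈ Finset.range n, gammaFactor t (x + a + j) := by
  -- the factors of `gammaFactor_mul_rpow_le` telescope
  have key : (∏ j ∈ Finset.range n, gammaFactor t (x + j)) * gammaFactor t (x + n - 1) ^ a ≤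
      gammaFactor t (x - 1) ^ a * ∏ j ∈ Finset.range n, gammaFactor t (x + a + j) := by
    induction n with
    | zero => simp
    | succ n ih =>
      rw [Finset.prod_range_succ, Finset.prod_range_succ]
      have hn : (0 : ℝ) ≤ n := Nat.cast_nonneg n
      have h := gammaFactor_mul_rpow_le (t := t) (y := x + n) (a := a) (by linarith) ha
      have hP : 0 ≤ ∏ j ∈ Finset.range n, gammaFactor t (x + j) :=
        Finset.prod_nonneg fun j _ => (gammaFactor_pos _ _).le
      have h0 := (gammaFactor_pos t (x + a + n)).le
      rw [show x + ((n + 1 : ℕ) : ℝ) - 1 = x + n by push_cast; ring]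
      rw [show x + n + a = x + a + n by ring] at h
      calc _ = (∏ j ∈ Finset.range n, gammaFactor t (x + j)) *
            (gammaFactor t (x + n) * gammaFactor t (x + n) ^ a) := by ring
        _ ≤ (∏ j ∈ Finset.range n, gammaFactor t (x + j)) *
            (gammaFactor t (x + n - 1) ^ a * gammaFactor t (x + a + n)) := by gcongr
        _ = ((∏ j ∈ Finset.range n, gammaFactor t (x + j)) * gammaFactor t (x + n - 1) ^ a) *
            gammaFactor t (x + a + n) := by ring
        _ ≤ _ := by
          rw [← mul_assoc]
          gcongr
  refine le_trans ?_ key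
  exact le_mul_of_one_le_right (Finset.prod_nonneg fun j _ => (gammaFactor_pos _ _).le)
    (Real.one_le_rpow (one_le_gammaFactor _ _) ha)

/-- The approximants of Euler's limit formula satisfy the product formula for
`|Γ(x) / Γ(x + it)|²`. -/
lemma sq_norm_GammaSeq {z : ℂ} (hz : 0 < z.re) {n : ℕ} (hn : n ≠ 0) :
    ‖GammaSeq z n‖ ^ 2 * ∏ j ∈ Finset.range (n + 1), gammaFactor z.im (z.re + j) =
      ‖GammaSeq z.re n‖ ^ 2 := by
  have h1 : ∀ j : ℕ, ‖z + j‖ ^ 2 = ‖(z.re : ℂ) + j‖ ^ 2 * gammaFactor z.im (z.re + j) := by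
    intro j
    have hpos : 0 < z.re + j := by positivity
    rw [Complex.sq_norm, Complex.sq_norm, normSq_apply, normSq_apply, gammaFactor]
    simp only [add_re, natCast_re, add_im, natCast_im, add_zero, ofReal_re, ofReal_im, mul_zero]
    field_simp
  have h2 : (∏ j ∈ Finset.range (n + 1), ‖z + j‖) ^ 2 =
      (∏ j ∈ Finset.range (n + 1), ‖(z.re : ℂ) + j‖) ^ 2 *
        ∏ j ∈ Finset.range (n + 1), gammaFactor z.im (z.re + j) := by
    rw [← Finset.prod_pow, ← Finset.prod_pow, ← Finset.prod_mul_distrib]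
    exact Finset.prod_congr rfl fun j _ => h1 j
  have h3 : 0 < ∏ j ∈ Finset.range (n + 1), gammaFactor z.im (z.re + j) :=
    Finset.prod_pos fun j _ => gammaFactor_pos _ _
  have h4 : 0 < ∏ j ∈ Finset.range (n + 1), ‖(z.re : ℂ) + j‖ := by
    refine Finset.prod_pos fun j _ => norm_pos_iff.mpr (ne_zero_of_re_pos ?_)
    simp only [add_re, ofReal_re, natCast_re]
    positivity
  rw [GammaSeq, GammaSeq, norm_div, norm_div, norm_mul, norm_mul, norm_prod, norm_prod,
    norm_natCast_cpow_of_pos (Nat.pos_of_ne_zero hn),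
    norm_natCast_cpow_of_pos (Nat.pos_of_ne_zero hn), ofReal_re, div_pow, div_pow, h2]
  field_simp

/-- `|Γ(z) / Γ(z + a)|` is at most its value at `Re z`. -/
lemma norm_Gamma_mul_le {z : ℂ} {a : ℝ} (hz : 0 < z.re) (ha : 0 ≤ a) :
    ‖Gamma z‖ * ‖Gamma (z.re + a : ℝ)‖ ≤ ‖Gamma z.re‖ * ‖Gamma (z + a)‖ := by
  refine le_of_sq_le_sq ?_ (by positivity)
  rw [mul_pow, mul_pow]
  refine le_of_tendsto_of_tendsto
    (((GammaSeq_tendsto_Gamma z).norm.pow 2).mul ((GammaSeq_tendsto_Gamma _).norm.pow 2))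
    (((GammaSeq_tendsto_Gamma _).norm.pow 2).mul ((GammaSeq_tendsto_Gamma _).norm.pow 2)) ?_
  filter_upwards [eventually_ne_atTop 0] with n hn
  have h1 := sq_norm_GammaSeq hz hn
  have h2 := sq_norm_GammaSeq (z := z + a) (by simpa using by positivity) hn
  have hre : (z + a).re = z.re + a := by simp
  have him : (z + a).im = z.im := by simp
  rw [hre, him] at h2
  rw [← h1, ← h2]
  have h3 : ∏ j ∈ Finset.range (n + 1), gammaFactor z.im (z.re + a + j) ≤
      ∏ j ∈ Finset.range (n + 1), gammaFactor z.im (z.re + j) :=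
    Finset.prod_le_prod (fun j _ => (gammaFactor_pos _ _).le)
      fun j _ => gammaFactor_anti (by positivity) (by linarith)
  calc _ = ‖GammaSeq z n‖ ^ 2 * ‖GammaSeq (z + a) n‖ ^ 2 *
        ∏ j ∈ Finset.range (n + 1), gammaFactor z.im (z.re + a + j) := by ring
    _ ≤ ‖GammaSeq z n‖ ^ 2 * ‖GammaSeq (z + a) n‖ ^ 2 *
        ∏ j ∈ Finset.range (n + 1), gammaFactor z.im (z.re + j) := by gcongr
    _ = _ := by ring

/-- A form of Stirling's bound `|Γ(z + a) / Γ(z)| ≪ |z|^a`, with explicit constants. -/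
lemma sq_norm_Gamma_add_mul_le {z : ℂ} {a : ℝ} (hz : 1 < z.re) (ha : 0 ≤ a) :
    ‖Gamma (z + a)‖ ^ 2 * ‖Gamma z.re‖ ^ 2 ≤
      gammaFactor z.im (z.re - 1) ^ a * (‖Gamma (z.re + a : ℝ)‖ ^ 2 * ‖Gamma z‖ ^ 2) := by
  have hz0 : 0 < z.re := one_pos.trans hz
  refine le_of_tendsto_of_tendsto
    (((GammaSeq_tendsto_Gamma _).norm.pow 2).mul ((GammaSeq_tendsto_Gamma _).norm.pow 2))
    ((((GammaSeq_tendsto_Gamma _).norm.pow 2).mul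
      ((GammaSeq_tendsto_Gamma _).norm.pow 2)).const_mul _) ?_
  filter_upwards [eventually_ne_atTop 0] with n hn
  have h1 := sq_norm_GammaSeq hz0 hn
  have h2 := sq_norm_GammaSeq (z := z + a) (by simpa using by positivity) hn
  have hre : (z + a).re = z.re + a := by simp
  have him : (z + a).im = z.im := by simp
  rw [hre, him] at h2
  rw [← h1, ← h2]
  have h3 := prod_gammaFactor_le (t := z.im) hz ha (n + 1)
  calc _ = ‖GammaSeq z n‖ ^ 2 * ‖GammaSeq (z + a) n‖ ^ 2 *
        ∏ j ∈ Finset.range (n + 1), gammaFactor z.im (z.re + j) := by ring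
    _ ≤ ‖GammaSeq z n‖ ^ 2 * ‖GammaSeq (z + a) n‖ ^ 2 * (gammaFactor z.im (z.re - 1) ^ a *
        ∏ j ∈ Finset.range (n + 1), gammaFactor z.im (z.re + a + j)) := by gcongr
    _ = _ := by ring

lemma exists_Gamma_bounds : ∃ C : ℝ, 0 < C ∧ ∀ y : ℝ, 1 / 16 ≤ y → y ≤ 4 →
    C⁻¹ ≤ Real.Gamma y ∧ Real.Gamma y ≤ C := by
  have hcont : ContinuousOn Real.Gamma (Icc (1 / 16) 4) := fun y hy =>
    (Real.differentiableAt_Gamma fun m => by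
      have h1 : (0 : ℝ) ≤ m := Nat.cast_nonneg m
      have h2 := hy.1
      linarith).continuousAt.continuousWithinAt
  have hpos : ∀ y ∈ Icc (1 / 16 : ℝ) 4, 0 < Real.Gamma y := fun y hy =>
    Real.Gamma_pos_of_pos (lt_of_lt_of_le (by norm_num) hy.1)
  have hne : (Icc (1 / 16 : ℝ) 4).Nonempty := nonempty_Icc.mpr (by norm_num)
  obtain ⟨y₁, hy₁, hmin⟩ := isCompact_Icc.exists_isMinOn hne hcont
  obtain ⟨y₂, hy₂, hmax⟩ := isCompact_Icc.exists_isMaxOn hne hcont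
  have h1 := hpos y₁ hy₁
  have h2 := hpos y₂ hy₂
  refine ⟨max (Real.Gamma y₁)⁻¹ (Real.Gamma y₂), lt_max_of_lt_right h2, fun y ha hb => ⟨?_, ?_⟩⟩
  · exact (inv_le_of_inv_le₀ h1 (le_max_left _ _)).trans (hmin ⟨ha, hb⟩)
  · exact le_trans (hmax ⟨ha, hb⟩) (le_max_right _ _)

lemma norm_Gamma_ofReal {y : ℝ} (hy : 0 < y) : ‖Gamma (y : ℂ)‖ = Real.Gamma y := by
  rw [Gamma_ofReal, norm_real, Real.norm_of_nonneg (Real.Gamma_pos_of_pos hy).le]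

lemma exists_norm_Gamma_le : ∃ C : ℝ, 0 < C ∧ ∀ (z : ℂ) (a : ℝ), 1 / 16 ≤ z.re → z.re ≤ 2 →
    0 ≤ a → a ≤ 1 → ‖Gamma z‖ ≤ C * ‖Gamma (z + a)‖ := by
  obtain ⟨C, hC, hb⟩ := exists_Gamma_bounds
  refine ⟨C * C, by positivity, fun z a h1 h2 h3 h4 => ?_⟩
  have hz : 0 < z.re := by linarith
  have h := norm_Gamma_mul_le (z := z) hz h3
  rw [norm_Gamma_ofReal hz, norm_Gamma_ofReal (by positivity)] at h
  have h5 := (hb (z.re + a) (by linarith) (by linarith)).1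
  have h6 := (hb z.re h1 (by linarith)).2
  have h7 : ‖Gamma z‖ * C⁻¹ ≤ C * ‖Gamma (z + a)‖ :=
    calc ‖Gamma z‖ * C⁻¹ ≤ ‖Gamma z‖ * Real.Gamma (z.re + a) := by gcongr
      _ ≤ _ := h
      _ ≤ _ := by gcongr
  calc ‖Gamma z‖ = C * (‖Gamma z‖ * C⁻¹) := by field_simp
    _ ≤ C * (C * ‖Gamma (z + a)‖) := by gcongr
    _ = _ := by ring

lemma norm_le_norm_add_ofReal {z : ℂ} {a : ℝ} (hz : 0 ≤ z.re) (ha : 0 ≤ a) : ‖z‖ ≤ ‖z + a‖ := by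
  refine le_of_sq_le_sq ?_ (norm_nonneg _)
  rw [Complex.sq_norm, Complex.sq_norm, normSq_apply, normSq_apply]
  simp only [add_re, ofReal_re, add_im, ofReal_im, add_zero]
  nlinarith [mul_nonneg hz ha]

lemma exists_norm_Gamma_add_le : ∃ C : ℝ, 0 < C ∧ ∀ (z : ℂ) (a : ℝ), z.re = 1 / 4 →
    0 ≤ a → a ≤ 1 → ‖Gamma (z + a)‖ ≤ C * (1 + |z.im|) ^ a * ‖Gamma z‖ := by
  obtain ⟨C, hC, hb⟩ := exists_Gamma_bounds
  refine ⟨C * C, by positivity, fun z a hz ha ha1 => ?_⟩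
  have him := abs_nonneg z.im
  have hrec : ∀ v : ℂ, 0 < v.re → Gamma (v + 2) = (v + 1) * v * Gamma v := by
    intro v hv
    have h1 : v + 1 ≠ 0 := ne_zero_of_re_pos (by simp only [add_re, one_re]; linarith)
    rw [show v + 2 = v + 1 + 1 by ring, Gamma_add_one _ h1, Gamma_add_one _ (ne_zero_of_re_pos hv),
      mul_assoc]
  have hzre : 0 < z.re := by rw [hz]; norm_num
  have hzare : 0 < (z + a).re := by simp only [add_re, ofReal_re]; linarith
  -- `sq_norm_Gamma_add_mul_le` needs `Re z > 1`, hence the shift by `2`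
  have h2re : (z + 2).re = 9 / 4 := by
    simp only [add_re, hz]
    norm_num
  have h2im : (z + 2).im = z.im := by simp
  have h := sq_norm_Gamma_add_mul_le (z := z + 2) (a := a) (by rw [h2re]; norm_num) ha
  rw [norm_Gamma_ofReal (by rw [h2re]; norm_num),
    norm_Gamma_ofReal (by rw [h2re]; positivity), h2re, h2im] at h
  have h5 := (hb (9 / 4) (by norm_num) (by norm_num)).1
  have h6 := (hb (9 / 4 + a) (by linarith) (by linarith)).2
  have h60 : 0 < Real.Gamma (9 / 4 + a) := Real.Gamma_pos_of_pos (by positivity)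
  have h7 : gammaFactor z.im (9 / 4 - 1) ^ a ≤ ((1 + |z.im|) ^ a) ^ 2 := by
    rw [← Real.rpow_natCast, ← Real.rpow_mul (by positivity), mul_comm,
      Real.rpow_mul (by positivity)]
    refine Real.rpow_le_rpow (gammaFactor_pos _ _).le ?_ ha
    rw [gammaFactor, Nat.cast_ofNat, Real.rpow_two, ← sq_abs z.im]
    have : |z.im| ^ 2 / (9 / 4 - 1) ^ 2 ≤ |z.im| ^ 2 := div_le_self (by positivity) (by norm_num)
    nlinarith
  have h8 : ‖Gamma (z + 2 + a)‖ * C⁻¹ ≤ (1 + |z.im|) ^ a * (C * ‖Gamma (z + 2)‖) := by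
    refine le_of_sq_le_sq ?_ (by positivity)
    rw [mul_pow, mul_pow, mul_pow]
    calc _ ≤ ‖Gamma (z + 2 + a)‖ ^ 2 * Real.Gamma (9 / 4) ^ 2 := by gcongr
      _ ≤ _ := h
      _ ≤ _ := by gcongr
  rw [show z + 2 + a = z + a + 2 by ring, hrec _ hzre, hrec _ hzare, norm_mul, norm_mul, norm_mul,
    norm_mul] at h8
  have h9 : ‖z‖ ≤ ‖z + a‖ := norm_le_norm_add_ofReal hzre.le ha
  have h10 : ‖z + 1‖ ≤ ‖z + a + 1‖ := by
    have := norm_le_norm_add_ofReal (z := z + 1) (by simp only [add_re, one_re]; linarith) ha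
    rwa [add_right_comm] at this
  have h11 : 0 < ‖z + a‖ := norm_pos_iff.mpr (ne_zero_of_re_pos hzare)
  have h12 : 0 < ‖z + a + 1‖ := norm_pos_iff.mpr (ne_zero_of_re_pos (by
    simp only [add_re, one_re, ofReal_re] at hzare ⊢
    linarith))
  have h13 : ‖z + a + 1‖ * ‖z + a‖ * (‖Gamma (z + a)‖ * C⁻¹) ≤
      ‖z + a + 1‖ * ‖z + a‖ * ((1 + |z.im|) ^ a * (C * ‖Gamma z‖)) :=
    calc _ = ‖z + a + 1‖ * ‖z + a‖ * ‖Gamma (z + a)‖ * C⁻¹ := by ring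
      _ ≤ _ := h8
      _ ≤ (1 + |z.im|) ^ a * (C * (‖z + a + 1‖ * ‖z + a‖ * ‖Gamma z‖)) := by gcongr
      _ = _ := by ring
  have h14 := le_of_mul_le_mul_left h13 (by positivity)
  calc ‖Gamma (z + a)‖ = C * (‖Gamma (z + a)‖ * C⁻¹) := by field_simp
    _ ≤ C * ((1 + |z.im|) ^ a * (C * ‖Gamma z‖)) := by gcongr
    _ = _ := by ring

lemma norm_Gammaℝ (s : ℂ) : ‖Gammaℝ s‖ = Real.pi ^ (-(s.re / 2)) * ‖Gamma (s / 2)‖ := by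
  rw [Gammaℝ_def, norm_mul, norm_cpow_eq_rpow_re_of_pos Real.pi_pos]
  congr 2
  rw [show -s / 2 = ((-(1 / 2) : ℝ) : ℂ) * s by push_cast; ring, re_ofReal_mul]
  ring

lemma exists_norm_Gammaℝ_le : ∃ C : ℝ, 0 < C ∧ ∀ (s : ℂ) (u : ℝ), 1 / 8 ≤ s.re → s.re ≤ 4 →
    0 ≤ u → u ≤ 1 → ‖Gammaℝ s‖ ≤ C * ‖Gammaℝ (s + u)‖ := by
  obtain ⟨C, hC, h⟩ := exists_norm_Gamma_le
  refine ⟨Real.pi * C, by positivity, fun s u h1 h2 h3 h4 => ?_⟩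
  have hpi : 1 ≤ Real.pi := by linarith [Real.pi_gt_three]
  have hre : (s / 2).re = s.re / 2 := by simp
  have hs := h (s / 2) (u / 2) (by rw [hre]; linarith) (by rw [hre]; linarith) (by linarith)
    (by linarith)
  rw [norm_Gammaℝ, norm_Gammaℝ, add_div]
  push_cast at hs
  have hp : Real.pi ^ (-(s.re / 2)) ≤ Real.pi * Real.pi ^ (-((s + u).re / 2)) := by
    nth_rw 2 [← Real.rpow_one Real.pi]
    rw [← Real.rpow_add Real.pi_pos]
    refine Real.rpow_le_rpow_of_exponent_le hpi ?_
    simp only [add_re, ofReal_re]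
    linarith
  calc _ ≤ (Real.pi * Real.pi ^ (-((s + u).re / 2))) * (C * ‖Gamma (s / 2 + u / 2)‖) := by gcongr
    _ = _ := by ring

lemma exists_norm_Gammaℝ_add_le : ∃ C : ℝ, 0 < C ∧ ∀ (s : ℂ) (u : ℝ), s.re = 1 / 2 →
    0 ≤ u → u ≤ 1 → ‖Gammaℝ (s + u)‖ ≤ C * (2 + |s.im|) ^ (u / 2) * ‖Gammaℝ s‖ := by
  obtain ⟨C, hC, h⟩ := exists_norm_Gamma_add_le
  refine ⟨C, hC, fun s u hs h3 h4 => ?_⟩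
  have hpi : 1 ≤ Real.pi := by linarith [Real.pi_gt_three]
  have him := abs_nonneg s.im
  have hre : (s / 2).re = s.re / 2 := by simp
  have him2 : (s / 2).im = s.im / 2 := by simp
  have hs := h (s / 2) (u / 2) (by rw [hre, hs]; norm_num) (by linarith) (by linarith)
  rw [norm_Gammaℝ, norm_Gammaℝ, add_div]
  push_cast at hs
  rw [him2, abs_div, abs_two] at hs
  have hp : Real.pi ^ (-((s + u).re / 2)) ≤ Real.pi ^ (-(s.re / 2)) := by
    refine Real.rpow_le_rpow_of_exponent_le hpi ?_
    simp only [add_re, ofReal_re]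
    linarith
  have hT : (1 + |s.im| / 2) ^ (u / 2) ≤ (2 + |s.im|) ^ (u / 2) :=
    Real.rpow_le_rpow (by positivity) (by linarith) (by linarith)
  calc _ ≤ Real.pi ^ (-(s.re / 2)) * (C * (1 + |s.im| / 2) ^ (u / 2) * ‖Gamma (s / 2)‖) := by gcongr
    _ ≤ Real.pi ^ (-(s.re / 2)) * (C * (2 + |s.im|) ^ (u / 2) * ‖Gamma (s / 2)‖) := by gcongr
    _ = _ := by ring

end BaezDuarte

/-! ### Comparison of `ζ(s)` and `ζ(s + u)` on the critical line -/

namespace BaezDuarte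

open Filter Topology Complex ComplexConjugate

lemma Gammaℝ_conj (s : ℂ) : Gammaℝ (conj s) = conj (Gammaℝ s) := by
  have h2 : conj (2 : ℂ) = 2 := map_ofNat _ 2
  have h : conj (s / 2) = conj s / 2 := by rw [map_div₀, h2]
  rw [Gammaℝ_def, Gammaℝ_def, map_mul, ← Gamma_conj, h,
    show -conj s / 2 = conj (-s / 2) by rw [map_div₀, h2, map_neg],
    cpow_conj _ _ (by rw [arg_ofReal_of_nonneg Real.pi_pos.le]; exact Real.pi_ne_zero.symm),
    conj_ofReal]

lemma xi_conj {s : ℂ} (hs : 0 < s.re) : xi (conj s) = conj (xi s) := by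
  rcases eq_or_ne s 1 with rfl | h1
  · simp [xi]
  · have h1' : conj s ≠ 1 := fun h => h1 (by simpa using congrArg conj h)
    rw [xi_eq hs h1, xi_eq (by simpa using hs) h1', Gammaℝ_conj, riemannZeta_conj]
    simp

/-- By the functional equation, `|ξ|` is symmetric about the critical line. -/
lemma norm_xi_eq_of_re {s : ℂ} {u : ℝ} (hs : s.re = 1 / 2 - u / 2) (hu : u < 1) :
    ‖xi s‖ = ‖xi (s + u)‖ := by
  have h : s + u = 1 - conj s := by
    apply Complex.ext
    · simp [hs]
      ring
    · simp
  rw [h, xi_one_sub, xi_conj (by rw [hs]; linarith), RCLike.norm_conj]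

lemma exists_norm_xi_right : ∃ C : ℝ, 0 < C ∧ ∀ (s : ℂ) (u : ℝ), s.re = 3 → 0 ≤ u → u ≤ 1 →
    ‖xi s‖ ≤ C * ‖xi (s + u)‖ := by
  obtain ⟨C, hC, hG⟩ := exists_norm_Gammaℝ_le
  have hz := one_le_zetaTwo
  have hz0 : 0 < zetaTwo := by linarith
  refine ⟨C * zetaTwo ^ 2, by positivity, fun s u hs hu hu1 => ?_⟩
  have hne : ∀ v : ℂ, 3 ≤ v.re → v ≠ 1 := by
    rintro v hv rfl
    norm_num at hv
  have hure : (s + u).re = 3 + u := by simp [hs]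
  have h1 : ‖s‖ ≤ ‖s + u‖ := norm_le_norm_add_ofReal (by rw [hs]; norm_num) hu
  have h2 : ‖s - 1‖ ≤ ‖s + u - 1‖ := by
    have := norm_le_norm_add_ofReal (z := s - 1) (by rw [sub_re, hs]; norm_num) hu
    rwa [sub_add_eq_add_sub] at this
  have h3 := hG s u (by rw [hs]; norm_num) (by rw [hs]; norm_num) hu hu1
  have h4 := norm_riemannZeta_le (s := s) (by rw [hs]; norm_num)
  have h5 := norm_inv_riemannZeta_le (s := s + u) (by rw [hure]; linarith)
  have h6 : riemannZeta (s + u) ≠ 0 := riemannZeta_ne_zero_of_one_le_re (by rw [hure]; linarith)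
  have h7 : ‖riemannZeta s‖ ≤ zetaTwo ^ 2 * ‖riemannZeta (s + u)‖ := by
    rw [norm_inv, inv_le_iff_one_le_mul₀ (norm_pos_iff.mpr h6)] at h5
    calc ‖riemannZeta s‖ ≤ zetaTwo * 1 := by rwa [mul_one]
      _ ≤ zetaTwo * (zetaTwo * ‖riemannZeta (s + u)‖) := by gcongr
      _ = _ := by ring
  rw [xi_eq (by rw [hs]; norm_num) (hne s hs.ge), xi_eq (by rw [hure]; linarith)
    (hne _ (by rw [hure]; linarith)), norm_mul, norm_mul, norm_mul, norm_mul, norm_mul, norm_mul]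
  calc _ ≤ ‖s + u‖ * (C * ‖Gammaℝ (s + u)‖) *
        (‖s + u - 1‖ * (zetaTwo ^ 2 * ‖riemannZeta (s + u)‖)) := by gcongr
    _ = _ := by ring

/-- Under the Riemann hypothesis `|ξ(s)| ≪ |ξ(s + u)|` on the critical line, uniformly in `u`. On
the line `Re s = (1 - u) / 2` the two sides agree by the functional equation, on `Re s = 3` the
bound is elementary, and the Phragmén–Lindelöf principle applies to `ξ(s) / ξ(s + u)` between the
two lines. -/
lemma exists_norm_xi_le (hRH : ∀ s : ℂ, 1 / 2 < s.re → riemannZeta s ≠ 0) :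
    ∃ C : ℝ, 0 < C ∧ ∀ (s : ℂ) (u : ℝ), s.re = 1 / 2 → 0 < u → u ≤ 3 / 4 →
      ‖xi s‖ ≤ C * ‖xi (s + u)‖ := by
  obtain ⟨C, hC, hright⟩ := exists_norm_xi_right
  obtain ⟨CG, hCG, hG⟩ := exists_norm_Gammaℝ_le
  refine ⟨max 1 C, by positivity, fun s u hs hu hu1 => ?_⟩
  obtain ⟨A, hA, hlow⟩ := exists_rpow_le_norm_zetaReg hRH (δ := u / 2) (by positivity)
  have hne : ∀ z : ℂ, 1 / 2 - u / 2 ≤ z.re → xi (z + u) ≠ 0 := fun z hz =>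
    xi_ne_zero hRH (by
      simp only [add_re, ofReal_re]
      linarith)
  have hcl : closure (re ⁻¹' Ioo (1 / 2 - u / 2) 3) ⊆ {z : ℂ | 1 / 2 - u / 2 ≤ z.re} :=
    closure_minimal (fun z hz => hz.1.le) (isClosed_le continuous_const continuous_re)
  have hd : DiffContOnCl ℂ (fun z => xi z / xi (z + u)) (re ⁻¹' Ioo (1 / 2 - u / 2) 3) := by
    refine DifferentiableOn.diffContOnCl ?_
    refine DifferentiableOn.div differentiable_xi.differentiableOn ?_ fun z hz => hne z (hcl hz)
    exact (differentiable_xi.comp (differentiable_id.add_const _)).differentiableOn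
  have hB : (fun z => xi z / xi (z + u)) =O[comap (_root_.abs ∘ im) atTop ⊓
      𝓟 (re ⁻¹' Ioo (1 / 2 - u / 2) 3)]
      fun z => Real.exp ((2 + A) * Real.exp (1 * |z.im|)) := by
    refine Asymptotics.IsBigO.of_bound (CG * 40) ?_
    filter_upwards [mem_inf_of_right (mem_principal_self _)] with z hz
    have hz1 : 1 / 2 - u / 2 < z.re := hz.1
    have hz2 : z.re < 3 := hz.2
    have hz0 : 0 < z.re := by linarith
    have hure : (z + u).re = z.re + u := by simp
    have huim : (z + u).im = z.im := by simp
    have hzu0 : 0 < (z + u).re := by rw [hure]; linarith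
    have him := abs_nonneg z.im
    have hT : 0 < 2 + |z.im| := by positivity
    have h1 : ‖z‖ ≤ ‖z + u‖ := norm_le_norm_add_ofReal hz0.le hu.le
    have h2 := hG z u (by linarith) (by linarith) hu.le (by linarith)
    have h3 := norm_zetaReg_le (s := z) (by linarith) (by linarith)
    have h4 := hlow (z + u) (by rw [hure]; linarith)
    rw [huim] at h4
    have h5 : 0 < ‖xi (z + u)‖ := norm_pos_iff.mpr (hne z hz1.le)
    have h6 : ‖zetaReg z‖ ≤ 40 * (2 + |z.im|) ^ (2 + A) * ‖zetaReg (z + u)‖ := by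
      rw [Real.rpow_add hT, Real.rpow_two]
      calc ‖zetaReg z‖ ≤ 40 * (2 + |z.im|) ^ 2 := h3
        _ = 40 * ((2 + |z.im|) ^ 2 * (2 + |z.im|) ^ A) * (2 + |z.im|) ^ (-A) := by
          rw [mul_assoc, mul_assoc, ← Real.rpow_add hT, add_neg_cancel, Real.rpow_zero, mul_one]
        _ ≤ _ := by gcongr
    have h7 : (2 + |z.im|) ^ (2 + A) ≤ Real.exp ((2 + A) * Real.exp (1 * |z.im|)) := by
      rw [Real.rpow_def_of_pos hT, mul_comm, one_mul]
      refine Real.exp_le_exp.mpr (mul_le_mul_of_nonneg_left ?_ (by positivity))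
      have h8 := Real.log_le_sub_one_of_pos hT
      have h9 := Real.add_one_le_exp |z.im|
      linarith
    rw [norm_div, div_le_iff₀ h5, Real.norm_of_nonneg (Real.exp_pos _).le, xi_eq_zetaReg hz0,
      xi_eq_zetaReg hzu0, norm_mul, norm_mul, norm_mul, norm_mul]
    calc _ ≤ ‖z + u‖ * (CG * ‖Gammaℝ (z + u)‖) *
          (40 * Real.exp ((2 + A) * Real.exp (1 * |z.im|)) * ‖zetaReg (z + u)‖) := by
          gcongr
          exact h6.trans (by gcongr)
      _ = _ := by ring
  have hmain := PhragmenLindelof.vertical_strip (z := s) (C := max 1 C) hd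
    ⟨1, by
      rw [lt_div_iff₀ (by linarith)]
      linarith [Real.pi_gt_three], _, hB⟩
    (fun z hz => by
      have h0 : 0 < ‖xi (z + u)‖ := norm_pos_iff.mpr (hne z hz.ge)
      rw [norm_div, norm_xi_eq_of_re hz (by linarith), div_self h0.ne']
      exact le_max_left _ _)
    (fun z hz => by
      have h0 : 0 < ‖xi (z + u)‖ := norm_pos_iff.mpr (hne z (by rw [hz]; linarith))
      rw [norm_div, div_le_iff₀ h0]
      refine (hright z u hz hu.le (by linarith)).trans ?_
      gcongr
      exact le_max_right _ _)
    (by rw [hs]; linarith) (by rw [hs]; norm_num)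
  have h0 : 0 < ‖xi (s + u)‖ := norm_pos_iff.mpr (hne s (by rw [hs]; linarith))
  rwa [norm_div, div_le_iff₀ h0] at hmain

lemma norm_eq_norm_sub_one {s : ℂ} (hs : s.re = 1 / 2) : ‖s - 1‖ = ‖s‖ := by
  have h : s - 1 = -conj s := by
    apply Complex.ext
    · simp [hs]
      norm_num
    · simp
  rw [h, norm_neg, RCLike.norm_conj]

lemma le_norm_of_re {s : ℂ} (hs : s.re = 1 / 2) : (2 + |s.im|) / 6 ≤ ‖s‖ := by
  have h1 := abs_re_le_norm s
  have h2 := abs_im_le_norm s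
  rw [hs, abs_of_pos (by norm_num)] at h1
  linarith

/-- Removing the Gamma factors from `exists_norm_xi_le` costs a factor `|Im s|^(u/2)`. -/
lemma exists_norm_zetaReg_le (hRH : ∀ s : ℂ, 1 / 2 < s.re → riemannZeta s ≠ 0) :
    ∃ C : ℝ, 0 < C ∧ ∀ (s : ℂ) (u : ℝ), s.re = 1 / 2 → 0 < u → u ≤ 3 / 4 →
      ‖zetaReg s‖ ≤ C * (2 + |s.im|) ^ (u / 2) * ‖zetaReg (s + u)‖ := by
  obtain ⟨C, hC, hxi⟩ := exists_norm_xi_le hRH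
  obtain ⟨CG, hCG, hG⟩ := exists_norm_Gammaℝ_add_le
  refine ⟨C * 3 * CG, by positivity, fun s u hs hu hu1 => ?_⟩
  have hs0 : 0 < s.re := by rw [hs]; norm_num
  have hsu0 : 0 < (s + u).re := by simp only [add_re, ofReal_re]; linarith
  have h1 := hxi s u hs hu hu1
  have h2 := hG s u hs hu.le (by linarith)
  have h3 : ‖s + u‖ ≤ 3 * ‖s‖ := by
    have h4 := abs_re_le_norm s
    rw [hs, abs_of_pos (by norm_num)] at h4
    have h5 := norm_add_le s u
    rw [norm_real, Real.norm_of_nonneg hu.le] at h5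
    linarith
  have hp : 0 < ‖s‖ * ‖Gammaℝ s‖ :=
    mul_pos (norm_pos_iff.mpr (ne_zero_of_re_pos hs0)) (norm_pos_iff.mpr (Gammaℝ_ne_zero hs0))
  have him := abs_nonneg s.im
  rw [xi_eq_zetaReg hs0, xi_eq_zetaReg hsu0, norm_mul, norm_mul, norm_mul, norm_mul] at h1
  refine le_of_mul_le_mul_left (h1.trans ?_) hp
  calc _ ≤ C * ((3 * ‖s‖) * (CG * (2 + |s.im|) ^ (u / 2) * ‖Gammaℝ s‖) * ‖zetaReg (s + u)‖) := by
        gcongr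
    _ = _ := by ring

end BaezDuarte

/-! ### The Mellin–Plancherel isometry -/

namespace BaezDuarte

open Filter Topology Complex ComplexConjugate FourierTransform

/-- The Fourier transform on `L²` is given by the Fourier integral on `L¹ ∩ L²`. -/
lemma fourier_toLp_ae_eq {f : ℝ → ℂ} (h1 : Integrable f) (h2 : MemLp f 2) :
    (𝓕 (h2.toLp f) : Lp ℂ 2 (volume : Measure ℝ)) =ᵐ[volume] 𝓕 f := by
  refine ae_eq_of_integral_contDiff_smul_eq ?_ ?_ fun g hg hgc => ?_
  · exact (Lp.memLp _).locallyIntegrable (by norm_num)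
  · refine Continuous.locallyIntegrable ?_
    exact VectorFourier.fourierIntegral_continuous Real.continuous_fourierChar
      (by fun_prop) h1
  · have hG : HasCompactSupport fun x => (g x : ℂ) := hgc.comp_left (g := ofReal) ofReal_zero
    set G : SchwartzMap ℝ ℂ := hG.toSchwartzMap (ofRealCLM.contDiff.comp hg) with hGdef
    have hGx : ∀ x, G x = (g x : ℂ) := fun x => rfl
    have h3 := congrArg (fun T => T G) (Lp.fourier_toTemperedDistribution_eq (h2.toLp f))
    simp only [TemperedDistribution.fourier_apply, Lp.toTemperedDistribution_apply] at h3
    have h4 := VectorFourier.integral_fourierIntegral_smul_eq_flip (L := innerₗ ℝ)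
      (μ := (volume : Measure ℝ)) (ν := (volume : Measure ℝ)) Real.continuous_fourierChar
      continuous_inner G.integrable h1
    have h5 : ∫ x, (𝓕 G) x • (h2.toLp f) x = ∫ x, (𝓕 G) x • f x := by
      refine integral_congr_ae ?_
      filter_upwards [h2.coeFn_toLp] with x hx
      rw [hx]
    rw [h5] at h3
    simp only [← coe_smul, ← hGx]
    rw [← h3]
    simp only [SchwartzMap.fourier_coe]
    rw [flip_innerₗ] at h4
    exact h4

lemma ae_comp_exp_neg {p : ℝ → Prop} (h : ∀ᵐ t ∂weight, p t) : ∀ᵐ x : ℝ, p (Real.exp (-x)) := by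
  have h1 := ae_restrict_of_ae_weight h
  rw [ae_restrict_iff' measurableSet_Ioi, ae_iff] at h1
  have h2 := addHaar_image_eq_zero_of_differentiableOn_of_addHaar_eq_zero (volume : Measure ℝ)
    (f := fun t => -Real.log t) (s := {t | ¬(t ∈ Ioi (0 : ℝ) → p t)}) (fun t ht => by
      have h0 : t ∈ Ioi (0 : ℝ) := by
        by_contra h0
        exact ht fun h => absurd h h0
      exact (Real.differentiableAt_log (ne_of_gt h0)).neg.differentiableWithinAt) h1
  rw [ae_iff]
  refine measure_mono_null (fun x hx => ?_) h2
  exact ⟨Real.exp (-x), fun h => hx (h (Real.exp_pos _)), by simp⟩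

/-- The function `f(e⁻ˣ) e^(x/2)`; the change of variables `t = e⁻ˣ` turns `L²(0, ∞; t⁻² dt)` into
`L²(ℝ)`. -/
noncomputable def logFun (f : ℝ → ℂ) (x : ℝ) : ℂ := f (Real.exp (-x)) * (Real.exp (x / 2) : ℝ)

lemma image_exp_neg : (fun x : ℝ => Real.exp (-x)) '' univ = Ioi 0 := by
  ext t
  simp only [image_univ, mem_range, mem_Ioi]
  exact ⟨fun ⟨x, hx⟩ => hx ▸ Real.exp_pos _, fun ht => ⟨-Real.log t, by
    rw [neg_neg, Real.exp_log ht]⟩⟩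

/-- The change of variables `t = e⁻ˣ`, with `t⁻² dt = eˣ dx`. -/
lemma eLpNorm_logFun {f : ℝ → ℂ} (hf : Measurable f) :
    eLpNorm (logFun f) 2 volume = eLpNorm f 2 weight := by
  rw [eLpNorm_eq_lintegral_rpow_enorm_toReal two_ne_zero ENNReal.ofNat_ne_top,
    eLpNorm_eq_lintegral_rpow_enorm_toReal two_ne_zero ENNReal.ofNat_ne_top]
  congr 1
  rw [weight, lintegral_withDensity_eq_lintegral_mul _ (by fun_prop) (by fun_prop), ← image_exp_neg,
    lintegral_image_eq_lintegral_abs_deriv_mul MeasurableSet.univ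
      (f' := fun x => -Real.exp (-x))
      (fun x _ => by
        have := ((hasDerivAt_id x).neg.exp).hasDerivWithinAt (s := univ)
        simpa using this)
      (fun x _ y _ hxy => by simpa using hxy), setLIntegral_univ]
  refine lintegral_congr fun x => ?_
  simp only [logFun, Pi.mul_apply, abs_neg, abs_of_pos (Real.exp_pos _), enorm_mul,
    ENNReal.toReal_ofNat, ENNReal.rpow_two, mul_pow]
  rw [← mul_assoc, ← ENNReal.ofReal_mul (Real.exp_pos _).le, mul_comm]
  congr 1
  rw [← ofReal_norm, norm_real, Real.norm_of_nonneg (Real.exp_pos _).le,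
    ← ENNReal.ofReal_pow (Real.exp_pos _).le]
  congr 1
  rw [one_div, ← Real.exp_nat_mul, ← Real.exp_nat_mul, ← Real.exp_neg, ← Real.exp_add]
  congr 1
  push_cast
  ring

lemma measurable_logFun {f : ℝ → ℂ} (hf : Measurable f) : Measurable (logFun f) :=
  (hf.comp (by fun_prop)).mul (by fun_prop)

lemma memLp_logFun {f : ℝ → ℂ} (hf : Measurable f) (h : MemLp f 2 weight) :
    MemLp (logFun f) 2 volume :=
  ⟨(measurable_logFun hf).aestronglyMeasurable, by
    rw [eLpNorm_logFun hf]
    exact h.2⟩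

lemma logFun_ae_eq {f g : ℝ → ℂ} (h : f =ᵐ[weight] g) : logFun f =ᵐ[volume] logFun g := by
  filter_upwards [ae_comp_exp_neg h] with x hx
  rw [logFun, logFun, hx]

lemma measurable_coeFn (f : H) : Measurable f := (Lp.stronglyMeasurable f).measurable

/-- The isometry `H → L²(ℝ)` induced by `logFun`. -/
noncomputable def logIsometry : H →ₗᵢ[ℂ] Lp ℂ 2 (volume : Measure ℝ) where
  toFun f := (memLp_logFun (measurable_coeFn f) (Lp.memLp f)).toLp (logFun f)
  map_add' f g := by
    rw [← MemLp.toLp_add, MemLp.toLp_eq_toLp_iff]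
    refine (logFun_ae_eq (Lp.coeFn_add f g)).trans (Eventually.of_forall fun x => ?_)
    simp only [logFun, Pi.add_apply]
    ring
  map_smul' c f := by
    rw [RingHom.id_apply, ← MemLp.toLp_const_smul, MemLp.toLp_eq_toLp_iff]
    refine (logFun_ae_eq (Lp.coeFn_smul c f)).trans (Eventually.of_forall fun x => ?_)
    simp only [logFun, Pi.smul_apply, smul_eq_mul]
    ring
  norm_map' f := by
    change ‖(memLp_logFun (measurable_coeFn f) (Lp.memLp f)).toLp (logFun f)‖ = ‖f‖
    rw [Lp.norm_toLp, eLpNorm_logFun (measurable_coeFn f), Lp.norm_def]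

lemma logIsometry_toLp {f : ℝ → ℂ} (hf : Measurable f) (h : MemLp f 2 weight) :
    logIsometry (h.toLp f) = (memLp_logFun hf h).toLp (logFun f) := by
  change (memLp_logFun (measurable_coeFn _) (Lp.memLp _)).toLp (logFun (h.toLp f)) = _
  rw [MemLp.toLp_eq_toLp_iff]
  exact logFun_ae_eq h.coeFn_toLp

/-- The Mellin–Plancherel isometry: `f` is mapped to its Mellin transform on a vertical line. -/
noncomputable def mellinIsometry : H →ₗᵢ[ℂ] Lp ℂ 2 (volume : Measure ℝ) :=
  (Lp.fourierTransformₗᵢ ℝ ℂ).toLinearIsometry.comp logIsometry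

/-- The parametrization `ξ ↦ 1/2 - 2πiξ` of the critical line. -/
noncomputable def critLine (ξ : ℝ) : ℂ := 1 / 2 - 2 * Real.pi * ξ * I

@[simp] lemma critLine_re (ξ : ℝ) : (critLine ξ).re = 1 / 2 := by
  simp [critLine]

lemma critLine_im (ξ : ℝ) : (critLine ξ).im = -(2 * Real.pi * ξ) := by
  simp [critLine]

lemma continuous_critLine : Continuous critLine := by
  unfold critLine
  fun_prop

lemma mellin_eq_fourier_logFun (f : ℝ → ℂ) (ξ : ℝ) :
    mellin f (-critLine ξ) = 𝓕 (logFun f) ξ := by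
  rw [mellin_eq_fourier]
  have h1 : (-critLine ξ).im / (2 * Real.pi) = ξ := by
    rw [neg_im, critLine_im, neg_neg]
    field_simp
  rw [h1]
  refine congrArg (fun F : ℝ → ℂ => 𝓕 F ξ) (funext fun x => ?_)
  rw [logFun, neg_re, critLine_re, neg_neg, real_smul, mul_comm]
  congr 3
  ring

lemma integrable_logFun {f : ℝ → ℂ} (h : MellinConvergent f (-(1 / 2))) :
    Integrable (logFun f) := by
  rw [MellinConvergent, ← image_exp_neg, integrableOn_image_iff_integrableOn_abs_deriv_smul
      MeasurableSet.univ (f' := fun x => -Real.exp (-x))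
      (fun x _ => by
        have := ((hasDerivAt_id x).neg.exp).hasDerivWithinAt (s := univ)
        simpa using this)
      (fun x _ y _ hxy => by simpa using hxy), integrableOn_univ] at h
  refine h.congr (Eventually.of_forall fun x => ?_)
  simp only [logFun, abs_neg, abs_of_pos (Real.exp_pos _), smul_eq_mul]
  have h1 : Real.exp (-x) * Real.exp (-x) ^ (-(3 / 2) : ℝ) = Real.exp (x / 2) := by
    rw [← Real.exp_mul, ← Real.exp_add]
    congr 1
    ring
  rw [← h1, real_smul, show (-(1 / 2) - 1 : ℂ) = ((-(3 / 2) : ℝ) : ℂ) by push_cast; norm_num,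
    ← ofReal_cpow (Real.exp_pos _).le]
  push_cast
  ring

lemma mellinIsometry_toLp {f : ℝ → ℂ} (hf : Measurable f) (h : MemLp f 2 weight)
    (hconv : MellinConvergent f (-(1 / 2))) :
    mellinIsometry (h.toLp f) =ᵐ[volume] fun ξ => mellin f (-critLine ξ) := by
  have h1 : mellinIsometry (h.toLp f) = 𝓕 ((memLp_logFun hf h).toLp (logFun f)) := by
    rw [← logIsometry_toLp hf h]
    rfl
  rw [h1]
  refine (fourier_toLp_ae_eq (integrable_logFun hconv) (memLp_logFun hf h)).trans ?_
  exact Eventually.of_forall fun ξ => (mellin_eq_fourier_logFun f ξ).symm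

end BaezDuarte

/-! ### From the Riemann hypothesis to `χ ∈ closure B` -/

namespace BaezDuarte

open Filter Topology Complex ComplexConjugate

lemma countable_riemannZetaZeros : riemannZetaZeros.Countable :=
  (HereditarilyLindelofSpace.isLindelof riemannZetaZeros).countable_of_isDiscrete
    isDiscrete_riemannZetaZeros

lemma critLine_injective : Function.Injective critLine := by
  intro x y h
  have h1 := congrArg im h
  rw [critLine_im, critLine_im, neg_inj] at h1
  exact mul_left_cancel₀ (by positivity) h1

lemma ae_riemannZeta_critLine_ne_zero : ∀ᵐ ξ : ℝ, riemannZeta (critLine ξ) ≠ 0 :=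
  (countable_riemannZetaZeros.preimage_of_injOn critLine_injective.injOn).ae_notMem volume

lemma critLine_re_pos (ξ : ℝ) : 0 < (critLine ξ).re := by
  rw [critLine_re]
  norm_num

lemma critLine_ne_one (ξ : ℝ) : critLine ξ ≠ 1 := by
  intro h
  have := congrArg re h
  rw [critLine_re, one_re] at this
  norm_num at this

/-- The weight `2 + |Im s|` at the point `s = 1/2 - 2πiξ`. -/
noncomputable def critHeight (ξ : ℝ) : ℝ := 2 + |(critLine ξ).im|

lemma two_le_critHeight (ξ : ℝ) : 2 ≤ critHeight ξ := by
  have := abs_nonneg (critLine ξ).im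
  rw [critHeight]
  linarith

lemma continuous_critHeight : Continuous critHeight :=
  continuous_const.add (continuous_im.comp continuous_critLine).abs

lemma memLp_critHeight_rpow : MemLp (fun ξ => critHeight ξ ^ (-(9 / 16) : ℝ)) 2 volume := by
  have hcont : Continuous fun ξ => critHeight ξ ^ (-(9 / 16) : ℝ) :=
    continuous_critHeight.rpow_const fun ξ => Or.inl (by linarith [two_le_critHeight ξ])
  rw [memLp_two_iff_integrable_sq_norm hcont.aestronglyMeasurable]
  refine Integrable.mono' (g := fun ξ : ℝ => (1 + ‖ξ‖) ^ (-(9 / 8) : ℝ))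
    (integrable_one_add_norm (by norm_num)) (hcont.norm.pow 2).aestronglyMeasurable ?_
  refine Eventually.of_forall fun ξ => ?_
  have h2 := two_le_critHeight ξ
  have h0 : 0 < critHeight ξ := by linarith
  have h1 : 1 + ‖ξ‖ ≤ critHeight ξ := by
    rw [critHeight, critLine_im, abs_neg, abs_mul, abs_of_pos (by positivity), Real.norm_eq_abs]
    have := abs_nonneg ξ
    nlinarith [Real.pi_gt_three]
  rw [Real.norm_of_nonneg (by positivity), Real.norm_of_nonneg (by positivity),
    ← Real.rpow_natCast, ← Real.rpow_mul h0.le,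
    show -(9 / 16 : ℝ) * (2 : ℕ) = -(9 / 8) by push_cast; norm_num]
  exact Real.rpow_le_rpow_of_nonpos (by positivity) h1 (by norm_num)

/-- The function `ζ(s) / (s ζ(s + w))` on the critical line, with the singularity at `s + w = 1`
removed. -/
noncomputable def quotKernel (w : ℂ) (ξ : ℝ) : ℂ :=
  zetaReg (critLine ξ) * (critLine ξ + w - 1) /
    (critLine ξ * (critLine ξ - 1) * zetaReg (critLine ξ + w))

lemma critLine_add_re (w : ℂ) (ξ : ℝ) : (critLine ξ + w).re = 1 / 2 + w.re := by
  rw [add_re, critLine_re]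

lemma quotKernel_eq {w : ℂ} (hw : 1 / 2 < w.re) (ξ : ℝ) :
    quotKernel w ξ = riemannZeta (critLine ξ) / critLine ξ * (riemannZeta (critLine ξ + w))⁻¹ := by
  have hre := critLine_add_re w ξ
  have h1 : critLine ξ + w ≠ 1 := fun h => by
    rw [h, one_re] at hre
    linarith
  have h2 := sub_ne_zero.mpr h1
  have h3 := sub_ne_zero.mpr (critLine_ne_one ξ)
  have h4 := ne_zero_of_re_pos (critLine_re_pos ξ)
  have h5 : riemannZeta (critLine ξ + w) ≠ 0 :=
    riemannZeta_ne_zero_of_one_le_re (by linarith)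
  rw [quotKernel, zetaReg_eq (critLine_re_pos ξ) (critLine_ne_one ξ),
    zetaReg_eq (by linarith) h1]
  field_simp

lemma differentiableOn_quotKernel (hRH : ∀ s : ℂ, 1 / 2 < s.re → riemannZeta s ≠ 0) (ξ : ℝ) :
    DifferentiableOn ℂ (fun w => quotKernel w ξ) {w | 0 < w.re} := by
  have h3 := sub_ne_zero.mpr (critLine_ne_one ξ)
  have h4 := ne_zero_of_re_pos (critLine_re_pos ξ)
  have hre : ∀ w ∈ {w : ℂ | 0 < w.re}, 1 / 2 < (critLine ξ + w).re := fun w hw => by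
    have hw' : 0 < w.re := hw
    rw [critLine_add_re]
    linarith
  refine DifferentiableOn.div (by fun_prop) ?_ fun w hw =>
    mul_ne_zero (mul_ne_zero h4 h3) (zetaReg_ne_zero hRH (hre w hw))
  refine DifferentiableOn.const_mul ?_ _
  refine differentiableOn_zetaReg.comp (by fun_prop) fun w hw => ?_
  have := hre w hw
  simp only [mem_ofPred_eq]
  linarith

lemma continuous_quotKernel (hRH : ∀ s : ℂ, 1 / 2 < s.re → riemannZeta s ≠ 0) {w : ℂ}
    (hw : 0 < w.re) : Continuous (quotKernel w) := by
  have hcomp : ∀ v : ℂ, 0 ≤ v.re → Continuous fun ξ => zetaReg (critLine ξ + v) := by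
    intro v hv
    refine differentiableOn_zetaReg.continuousOn.comp_continuous
      (continuous_critLine.add continuous_const) fun ξ => ?_
    simp only [mem_ofPred_eq, critLine_add_re]
    linarith
  have h0 : Continuous fun ξ => zetaReg (critLine ξ) := by simpa using hcomp 0 le_rfl
  have hc := continuous_critLine
  refine Continuous.div (h0.mul (by fun_prop)) ((by fun_prop : Continuous fun ξ =>
    critLine ξ * (critLine ξ - 1)).mul (hcomp w hw.le)) fun ξ => ?_
  exact mul_ne_zero (mul_ne_zero (ne_zero_of_re_pos (critLine_re_pos ξ))
    (sub_ne_zero.mpr (critLine_ne_one ξ))) (zetaReg_ne_zero hRH (by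
      rw [critLine_add_re]
      linarith))

/-- A bound for `|ζ(s)| / |ζ(s + w)|` with exponent `7/16 < 1/2` makes the kernel square
integrable. -/
lemma norm_quotKernel_le (hRH : ∀ s : ℂ, 1 / 2 < s.re → riemannZeta s ≠ 0) {w : ℂ}
    {ξ C : ℝ} (hw : 0 < w.re) (hw2 : ‖w‖ ≤ 2)
    (h : ‖zetaReg (critLine ξ)‖ ≤ C * critHeight ξ ^ (7 / 16 : ℝ) * ‖zetaReg (critLine ξ + w)‖) :
    ‖quotKernel w ξ‖ ≤ 30 * C * critHeight ξ ^ (-(9 / 16) : ℝ) := by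
  have hT : 0 < critHeight ξ := by linarith [two_le_critHeight ξ]
  have hz : 0 < ‖zetaReg (critLine ξ + w)‖ := norm_pos_iff.mpr (zetaReg_ne_zero hRH (by
    rw [critLine_add_re]
    linarith))
  have h1 := le_norm_of_re (critLine_re ξ)
  change critHeight ξ / 6 ≤ _ at h1
  have hs : 0 < ‖critLine ξ‖ := by linarith [div_pos hT (show (0 : ℝ) < 6 by norm_num)]
  have h2 : ‖critLine ξ + w - 1‖ ≤ 5 * ‖critLine ξ‖ := by
    have h3 := norm_add_le (critLine ξ - 1) w
    rw [norm_eq_norm_sub_one (critLine_re ξ), sub_add_eq_add_sub] at h3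
    have h4 := abs_re_le_norm (critLine ξ)
    rw [critLine_re, abs_of_pos (by norm_num)] at h4
    linarith
  rw [quotKernel, norm_div, norm_mul, norm_mul, norm_mul, norm_eq_norm_sub_one (critLine_re ξ),
    div_le_iff₀ (by positivity)]
  have hC : 0 ≤ C * critHeight ξ ^ (7 / 16 : ℝ) := by
    by_contra hneg
    have := mul_neg_of_neg_of_pos (not_le.mp hneg) hz
    linarith [norm_nonneg (zetaReg (critLine ξ))]
  have hpow : critHeight ξ ^ (7 / 16 : ℝ) = critHeight ξ ^ (-(9 / 16) : ℝ) * critHeight ξ := by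
    rw [← Real.rpow_add_one hT.ne']
    norm_num
  calc _ ≤ (C * critHeight ξ ^ (7 / 16 : ℝ) * ‖zetaReg (critLine ξ + w)‖) *
        (5 * ‖critLine ξ‖) := by gcongr
    _ = 30 * (C * critHeight ξ ^ (-(9 / 16) : ℝ)) * (critHeight ξ / 6) *
        ‖critLine ξ‖ * ‖zetaReg (critLine ξ + w)‖ := by
        rw [hpow]
        ring
    _ ≤ 30 * (C * critHeight ξ ^ (-(9 / 16) : ℝ)) * ‖critLine ξ‖ *
        ‖critLine ξ‖ * ‖zetaReg (critLine ξ + w)‖ := by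
        have : 0 ≤ C * critHeight ξ ^ (-(9 / 16) : ℝ) := by
          rw [hpow] at hC
          rw [← mul_assoc] at hC
          exact nonneg_of_mul_nonneg_left hC hT
        gcongr
    _ = _ := by ring

/-- The bound for real `w` is uniform down to `w = 0`. -/
lemma exists_norm_quotKernel_ofReal_le (hRH : ∀ s : ℂ, 1 / 2 < s.re → riemannZeta s ≠ 0) :
    ∃ C : ℝ, ∀ (u ξ : ℝ), 0 < u → u ≤ 3 / 4 →
      ‖quotKernel u ξ‖ ≤ C * critHeight ξ ^ (-(9 / 16) : ℝ) := by
  obtain ⟨C, hC, h⟩ := exists_norm_zetaReg_le hRH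
  refine ⟨30 * C, fun u ξ hu hu1 => norm_quotKernel_le hRH (by simpa using hu) ?_ ?_⟩
  · rw [norm_real, Real.norm_of_nonneg hu.le]
    linarith
  · refine (h (critLine ξ) u (critLine_re ξ) hu hu1).trans ?_
    change C * critHeight ξ ^ (u / 2) * _ ≤ _
    have := Real.rpow_le_rpow_of_exponent_le (x := critHeight ξ) (y := u / 2) (z := 7 / 16)
      (by linarith [two_le_critHeight ξ]) (by linarith)
    gcongr

/-- The bound in a complex neighbourhood of a real point, whose constants depend on the point. -/
lemma exists_norm_quotKernel_le (hRH : ∀ s : ℂ, 1 / 2 < s.re → riemannZeta s ≠ 0) {u : ℝ}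
    (hu : 0 < u) (hu1 : u ≤ 3 / 4) :
    ∃ C η : ℝ, 0 < η ∧ ∀ w ∈ Metric.ball (u : ℂ) η, 0 < w.re ∧
      ∀ ξ : ℝ, ‖quotKernel w ξ‖ ≤ C * critHeight ξ ^ (-(9 / 16) : ℝ) := by
  obtain ⟨C, hC, h⟩ := exists_norm_zetaReg_le hRH
  obtain ⟨η, hη, hcomp⟩ := exists_zetaReg_comparison hRH hu (by linarith)
    (show (0 : ℝ) < 1 / 16 by norm_num)
  refine ⟨30 * C, min η u, lt_min hη hu, fun w hw => ?_⟩
  rw [Metric.mem_ball, dist_eq_norm, lt_min_iff] at hw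
  have hwre : 0 < w.re := by
    have h1 := (abs_re_le_norm (w - u)).trans_lt hw.2
    rw [sub_re, ofReal_re, abs_lt] at h1
    linarith
  refine ⟨hwre, fun ξ => norm_quotKernel_le hRH hwre ?_ ?_⟩
  · have h1 := norm_add_le (w - u) (u : ℂ)
    rw [sub_add_cancel, norm_real, Real.norm_of_nonneg hu.le] at h1
    linarith
  · have hT2 := two_le_critHeight ξ
    have hT : 0 < critHeight ξ := by linarith
    have h1 := h (critLine ξ) u (critLine_re ξ) hu hu1
    have h2 := hcomp (critLine ξ) w (critLine_re ξ) hw.1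
    change ‖zetaReg (critLine ξ)‖ ≤ C * critHeight ξ ^ (u / 2) * _ at h1
    change _ * critHeight ξ ^ (-(1 / 16) : ℝ) ≤ _ at h2
    calc ‖zetaReg (critLine ξ)‖ ≤ C * critHeight ξ ^ (u / 2) * ‖zetaReg (critLine ξ + u)‖ := h1
      _ ≤ C * critHeight ξ ^ (3 / 8 : ℝ) * ‖zetaReg (critLine ξ + u)‖ := by
        have := Real.rpow_le_rpow_of_exponent_le (x := critHeight ξ) (y := u / 2) (z := 3 / 8)
          (by linarith) (by linarith)
        gcongr
      _ = C * critHeight ξ ^ (7 / 16 : ℝ) *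
          (‖zetaReg (critLine ξ + u)‖ * critHeight ξ ^ (-(1 / 16) : ℝ)) := by
        rw [show (3 / 8 : ℝ) = 7 / 16 + -(1 / 16) by norm_num, Real.rpow_add hT]
        ring
      _ ≤ _ := by gcongr

lemma mellinIsometry_e {k : ℕ} (hk : 1 ≤ k) : mellinIsometry (e k) =ᵐ[volume]
    fun ξ => -((k : ℂ) ^ (-critLine ξ) * riemannZeta (critLine ξ) / critLine ξ) := by
  have hmeas : Measurable (eFun k) := by
    unfold eFun
    exact measurable_ofReal.comp (measurable_fract.comp (measurable_id.div_const _))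
  have hconv := (hasMellin_fract_div (s := 1 / 2) (by norm_num) (by norm_num) hk).1
  refine (mellinIsometry_toLp hmeas (memLp_eFun k) hconv).trans (Eventually.of_forall fun ξ => ?_)
  exact (hasMellin_fract_div (critLine_re_pos ξ) (by rw [critLine_re]; norm_num) hk).2

lemma mellinIsometry_chi : mellinIsometry chi =ᵐ[volume] fun ξ => 1 / critLine ξ := by
  have hmeas : Measurable chiFun := measurable_const.indicator measurableSet_Ici
  have hconv := (hasMellin_chiFun (s := 1 / 2) (by norm_num)).1
  refine (mellinIsometry_toLp hmeas memLp_chiFun hconv).trans (Eventually.of_forall fun ξ => ?_)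
  exact (hasMellin_chiFun (critLine_re_pos ξ)).2

lemma memLp_zeta_div : MemLp (fun ξ => riemannZeta (critLine ξ) / critLine ξ) 2 volume := by
  have h := (Lp.memLp (mellinIsometry (e 1))).ae_eq (mellinIsometry_e le_rfl)
  refine (memLp_congr_ae (Eventually.of_forall fun ξ => ?_)).mpr h.neg
  simp

section Duality

variable {g : Lp ℂ 2 (volume : Measure ℝ)}

lemma inner_eq_integral {f : Lp ℂ 2 (volume : Measure ℝ)} {F : ℝ → ℂ} (h : f =ᵐ[volume] F) :
    inner ℂ g f = ∫ ξ, F ξ * conj (g ξ) := by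
  rw [L2.inner_def]
  refine integral_congr_ae ?_
  filter_upwards [h] with ξ hξ
  rw [RCLike.inner_apply, hξ]

lemma memLp_conj : MemLp (fun ξ => conj (g ξ)) 2 volume := (Lp.memLp g).star

/-- In the half-plane `Re w > 1/2` the quotient `ζ(s) / (s ζ(s + w))` is the sum of an absolutely
convergent series of multiples of the Mellin transforms of the `e_k`. -/
lemma integral_quotKernel_eq_zero_of_re (hg : ∀ k, 1 ≤ k → inner ℂ g (mellinIsometry (e k)) = 0)
    {w : ℂ} (hw : 1 / 2 < w.re) : ∫ ξ, quotKernel w ξ * conj (g ξ) = 0 := by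
  set Z : ℝ → ℂ := fun ξ => riemannZeta (critLine ξ) / critLine ξ with hZ
  have hZg : Integrable fun ξ => Z ξ * conj (g ξ) := memLp_zeta_div.integrable_mul memLp_conj
  set F : ℕ → ℝ → ℂ := fun n ξ =>
    (ArithmeticFunction.moebius n : ℂ) * (n : ℂ) ^ (-(critLine ξ + w)) * (Z ξ * conj (g ξ)) with hF
  have hnorm : ∀ n ξ, ‖(ArithmeticFunction.moebius n : ℂ) * (n : ℂ) ^ (-(critLine ξ + w))‖ ≤
      (n : ℝ) ^ (-(1 / 2 + w.re)) := by
    intro n ξ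
    rcases Nat.eq_zero_or_pos n with rfl | hn
    · simp only [ArithmeticFunction.map_zero, Int.cast_zero, zero_mul, norm_zero]
      positivity
    · rw [norm_mul, norm_natCast_cpow_of_pos hn, neg_re, critLine_add_re]
      refine mul_le_of_le_one_left (by positivity) ?_
      rw [norm_intCast]
      exact_mod_cast ArithmeticFunction.abs_moebius_le_one
  have hmeasP : ∀ n : ℕ, Measurable fun ξ : ℝ =>
      (ArithmeticFunction.moebius n : ℂ) * (n : ℂ) ^ (-(critLine ξ + w)) := by
    intro n
    have := continuous_critLine.measurable
    fun_prop
  have hFint : ∀ n, Integrable (F n) := fun n =>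
    hZg.bdd_mul (hmeasP n).aestronglyMeasurable (Eventually.of_forall (hnorm n))
  have hFsum : Summable fun n => ∫ ξ, ‖F n ξ‖ := by
    refine Summable.of_nonneg_of_le (fun n => integral_nonneg fun ξ => norm_nonneg _) (fun n => ?_)
      ((Real.summable_nat_rpow (p := -(1 / 2 + w.re)).mpr (by linarith)).mul_right
        (∫ ξ, ‖Z ξ * conj (g ξ)‖))
    rw [← integral_const_mul]
    refine integral_mono (hFint n).norm (hZg.norm.const_mul _) fun ξ => ?_
    simp only [hF]
    rw [norm_mul]
    gcongr
    exact hnorm n ξ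
  have hzero : ∀ n, ∫ ξ, F n ξ = 0 := by
    intro n
    rcases Nat.eq_zero_or_pos n with rfl | hn
    · simp [hF]
    · have h1 := hg n hn
      rw [inner_eq_integral (mellinIsometry_e hn)] at h1
      have h2 : ∀ ξ, F n ξ = (-(ArithmeticFunction.moebius n : ℂ) * (n : ℂ) ^ (-w)) *
          (-((n : ℂ) ^ (-critLine ξ) * riemannZeta (critLine ξ) / critLine ξ) * conj (g ξ)) := by
        intro ξ
        have hn0 : (n : ℂ) ≠ 0 := by exact_mod_cast hn.ne'
        simp only [hF, hZ]
        rw [neg_add, cpow_add _ _ hn0]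
        ring
      simp_rw [h2]
      rw [integral_const_mul, h1, mul_zero]
  have hsum := hasSum_integral_of_summable_integral_norm hFint hFsum
  simp_rw [hzero] at hsum
  have h0 := hsum.unique hasSum_zero
  rw [← h0]
  refine integral_congr_ae (Eventually.of_forall fun ξ => ?_)
  simp only [hF]
  rw [tsum_mul_right, (hasSum_moebius (s := critLine ξ + w) (by
    rw [critLine_add_re]
    linarith)).tsum_eq, quotKernel_eq hw]
  ring

lemma integrable_critHeight_mul :
    Integrable fun ξ => critHeight ξ ^ (-(9 / 16) : ℝ) * ‖g ξ‖ :=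
  memLp_critHeight_rpow.integrable_mul (Lp.memLp g).norm

lemma analyticAt_integral_quotKernel (hRH : ∀ s : ℂ, 1 / 2 < s.re → riemannZeta s ≠ 0) {u : ℝ}
    (hu : 0 < u) (hu1 : u ≤ 3 / 4) :
    AnalyticAt ℂ (fun w => ∫ ξ, quotKernel w ξ * conj (g ξ)) u := by
  obtain ⟨C, η, hη, h⟩ := exists_norm_quotKernel_le hRH hu hu1
  refine DifferentiableOn.analyticAt (s := Metric.ball (u : ℂ) η) ?_ (Metric.ball_mem_nhds _ hη)
  refine differentiableOn_integral_of_dominated Metric.isOpen_ball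
    (bound := fun ξ => C * (critHeight ξ ^ (-(9 / 16) : ℝ) * ‖g ξ‖)) ?_ ?_ ?_
    (integrable_critHeight_mul.const_mul C)
  · exact fun w hw => (continuous_quotKernel hRH (h w hw).1).aestronglyMeasurable.mul
      memLp_conj.aestronglyMeasurable
  · exact fun ξ => ((differentiableOn_quotKernel hRH ξ).mono fun w hw => (h w hw).1).mul_const _
  · refine Eventually.of_forall fun ξ w hw => ?_
    rw [norm_mul, RCLike.norm_conj, ← mul_assoc]
    exact mul_le_mul_of_nonneg_right ((h w hw).2 ξ) (norm_nonneg _)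

/-- Analytic continuation in `w` along the real axis, from the half-plane `Re w > 1/2` of absolute
convergence to all of `(0, 3/4)`. -/
lemma integral_quotKernel_eq_zero (hRH : ∀ s : ℂ, 1 / 2 < s.re → riemannZeta s ≠ 0)
    (hg : ∀ k, 1 ≤ k → inner ℂ g (mellinIsometry (e k)) = 0) {u : ℝ} (hu : 0 < u)
    (hu1 : u < 3 / 4) : ∫ ξ, quotKernel u ξ * conj (g ξ) = 0 := by
  have hana : AnalyticOnNhd ℂ (fun w => ∫ ξ, quotKernel w ξ * conj (g ξ))
      (ofReal '' Ioo (0 : ℝ) (3 / 4)) := by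
    rintro _ ⟨v, hv, rfl⟩
    exact analyticAt_integral_quotKernel hRH hv.1 hv.2.le
  refine hana.eqOn_zero_of_preconnected_of_eventuallyEq_zero (z₀ := ((5 / 8 : ℝ) : ℂ))
    (isPreconnected_Ioo.image _ continuous_ofReal.continuousOn)
    ⟨5 / 8, by norm_num, rfl⟩ ?_ ⟨u, ⟨hu, hu1⟩, rfl⟩
  have hmem : ((5 / 8 : ℝ) : ℂ) ∈ {w : ℂ | 1 / 2 < w.re} := by
    simp only [mem_ofPred_eq, ofReal_re]
    norm_num
  filter_upwards [(isOpen_re_gt (1 / 2)).mem_nhds hmem] with w hw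
  exact integral_quotKernel_eq_zero_of_re hg hw

/-- As `u → 0+`, the kernels tend to the Mellin transform `1 / s` of `χ`, weakly in `L²`. -/
lemma inner_mellinIsometry_chi (hRH : ∀ s : ℂ, 1 / 2 < s.re → riemannZeta s ≠ 0)
    (hg : ∀ k, 1 ≤ k → inner ℂ g (mellinIsometry (e k)) = 0) :
    inner ℂ g (mellinIsometry chi) = 0 := by
  rw [inner_eq_integral mellinIsometry_chi]
  obtain ⟨C, hC⟩ := exists_norm_quotKernel_ofReal_le hRH
  set v : ℕ → ℝ := fun n => 1 / ((n : ℝ) + 2) with hv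
  have hv0 : ∀ n, 0 < v n := fun n => by positivity
  have hv1 : ∀ n, v n ≤ 1 / 2 := fun n =>
    one_div_le_one_div_of_le two_pos (by linarith [(Nat.cast_nonneg n : (0 : ℝ) ≤ n)])
  have hvlim : Tendsto (fun n => (v n : ℂ)) atTop (𝓝 0) := by
    have h1 : Tendsto v atTop (𝓝 0) := tendsto_const_nhds.div_atTop
      (tendsto_atTop_add_const_right _ _ tendsto_natCast_atTop_atTop)
    exact_mod_cast (continuous_ofReal.tendsto 0).comp h1
  have hlim := tendsto_integral_of_dominated_convergence
    (F := fun n ξ => quotKernel (v n) ξ * conj (g ξ))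
    (f := fun ξ => 1 / critLine ξ * conj (g ξ))
    (fun ξ => C * (critHeight ξ ^ (-(9 / 16) : ℝ) * ‖g ξ‖))
    (fun n => (continuous_quotKernel hRH
      (by simpa using hv0 n)).aestronglyMeasurable.mul memLp_conj.aestronglyMeasurable)
    (integrable_critHeight_mul.const_mul C)
    (fun n => Eventually.of_forall fun ξ => by
      rw [norm_mul, RCLike.norm_conj, ← mul_assoc]
      exact mul_le_mul_of_nonneg_right (hC _ ξ (hv0 n) (by linarith [hv1 n])) (norm_nonneg _)) ?_
  · refine tendsto_nhds_unique hlim (tendsto_const_nhds.congr fun n => ?_)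
    exact (integral_quotKernel_eq_zero hRH hg (hv0 n) (by linarith [hv1 n])).symm
  · filter_upwards [ae_riemannZeta_critLine_ne_zero] with ξ hξ
    refine Tendsto.mul_const _ ?_
    have h3 := sub_ne_zero.mpr (critLine_ne_one ξ)
    have h4 := ne_zero_of_re_pos (critLine_re_pos ξ)
    have h5 : zetaReg (critLine ξ) ≠ 0 := by
      rw [zetaReg_eq (critLine_re_pos ξ) (critLine_ne_one ξ)]
      exact mul_ne_zero h3 hξ
    have hcont : ContinuousAt (fun w : ℂ => quotKernel w ξ) 0 := by
      have h6 : ContinuousAt (fun w : ℂ => zetaReg (critLine ξ + w)) 0 := by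
        have h8 : ContinuousAt zetaReg (critLine ξ + 0) := by
          rw [add_zero]
          exact (differentiableOn_zetaReg.differentiableAt
            ((isOpen_re_gt 0).mem_nhds (critLine_re_pos ξ))).continuousAt
        exact h8.comp (f := fun w : ℂ => critLine ξ + w) (by fun_prop)
      refine ContinuousAt.div (by fun_prop) (h6.const_mul _) ?_
      rw [add_zero]
      exact mul_ne_zero (mul_ne_zero h4 h3) h5
    have h7 : quotKernel 0 ξ = 1 / critLine ξ := by
      rw [quotKernel, add_zero]
      field_simp
    rw [← h7]
    exact hcont.tendsto.comp hvlim

end Duality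

/-- Báez-Duarte's strengthening of the Nyman–Beurling criterion, in the direction which uses the
Riemann hypothesis. -/
theorem chi_mem_of_riemannHypothesis (h : RiemannHypothesis) : chi ∈ B.topologicalClosure := by
  have hRH := riemannHypothesis_iff.mp h
  set K := B.map mellinIsometry.toLinearMap with hK
  have hmem : mellinIsometry chi ∈ Kᗮᗮ := by
    rw [Submodule.mem_orthogonal]
    intro g hg
    refine inner_mellinIsometry_chi hRH fun k hk => ?_
    rw [Submodule.mem_orthogonal'] at hg
    exact hg _ (Submodule.mem_map_of_mem (Submodule.subset_span ⟨k, hk, rfl⟩))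
  -- an isometry of complete spaces maps closures onto closures
  rw [Submodule.orthogonal_orthogonal_eq_closure, ← SetLike.mem_coe,
    Submodule.topologicalClosure_coe, hK, Submodule.map_coe] at hmem
  change mellinIsometry chi ∈ closure (mellinIsometry '' (B : Set H)) at hmem
  rw [mellinIsometry.isometry.isClosedEmbedding.closure_image_eq,
    mellinIsometry.injective.mem_set_image] at hmem
  rwa [← SetLike.mem_coe, Submodule.topologicalClosure_coe]

end BaezDuarte

theorem mainTheorem1 :
    List.TFAE
      [∀ n : ℕ, 1 ≤ n → BaezDuarte.nu n = (ArithmeticFunction.moebius n : ℂ),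
       ∀ n : ℕ, 2 ≤ n → BaezDuarte.nu₀ n = (ArithmeticFunction.moebius n : ℂ),
       RiemannHypothesis] := by
  rw [BaezDuarte.forall_nu_iff, BaezDuarte.forall_nu₀_iff, BaezDuarte.chi_mem_closure_B₀_iff]
  tfae_have 1 → 3 := BaezDuarte.riemannHypothesis_of_chi_mem
  tfae_have 3 → 1 := BaezDuarte.chi_mem_of_riemannHypothesis
  tfae_have 1 ↔ 2 := Iff.rfl
  tfae_finish
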